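/- Let $N\cong\mathbb Z^d$ be a lattice with dual lattice $M=\operatorname{Hom}(N,\mathbb Z)$, $N_{\mathbb R}=N\otimes\mathbb R$, and let $P\subseteq N_{\mathbb R}$ be a rational polyhedron with at least one vertex. Write $\operatorname{tail}(P)=\{a: a+P\subseteq P\}$, $\operatorname{tail}(P)^\vee$ for its dual cone, and, for a linear form $c$, $\operatorname{face}(Q,c)=\{a\in Q:\langle c,a\rangle=\min\langle c,Q\rangle\}$. Let $r$ and $p$ be the numbers of compact edges and of vertices of $P$; elements of $\mathbb R^r\oplus\mathbb R^p$ are written $\xi=(t,s)$ with coordinates $t_{vw}=t_{wv}$ for the compact edges $[v,w]$ and $s_v$ for the vertices $v$. For a half-open edge $[v,w)$ let $g\ge 1$ be the least integer such that the affine line through $gv$ and $gw$ contains lattice points; $[v,w)$ is called short if $\#\big(g\cdot[v,w)\cap N\big)\le g-1$. The vector space $\mathcal T(P)\subseteq\mathbb R^r\oplus\mathbb R^p$ consists of all $(t,s)$ such that (a) for every compact $2$-dimensional face $F$ of $P$ the sum of $t_{vw}(w-v)$ over the edges $[v,w]$ of $F$, oriented as a cycle along $\partial F$, is $0$; (b)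 $s_v=0$ if $v\in N$; (c) $s_v=s_w$ if $[v,w]$ is a compact edge with $[v,w]\cap N=\emptyset$; (d) $s_v=t_{vw}$ if $[v,w]$ is a compact edge and $[v,w)$ is short. Let $\mathcal T_+(P)$ be the set of $(t,s)\in\mathcal T(P)$ with all coordinates $\ge 0$, and let $\mathcal T_{\mathbb Z}(P)$ be the set of $(t,s)\in\mathcal T(P)$ with $s_v\in\mathbb Z$ for all vertices $v$ and $(t_{vw}-s_v)v-(t_{vw}-s_w)w\in N$ for all compact edges $[v,w]$. The distinguished element $[P]\in\mathcal T(P)$ has all $t_{vw}=1$, $s_v=0$ for $v\in N$ and $s_v=1$ for $v\notin N$. Fix a reference vertex $v_*$ of $P$ with $v_*\notin N$ or $v_*=0$. For $\xi=(t,s)\in\mathcal T_+(P)$ and a vertex $v$ put $\psi(\xi,v)=s_{v_*}v_*+\sum_{i=1}^k t_{v^{i-1}v^i}(v^i-v^{i-1})$ for any path $v_*=v^0,\dots,v^k=v$ along compact edges (the result does not depend on the path), and let $P_\xi=\operatorname{conv}\{\psi(\xi,v): v \text{ a vertex of } P\}+\operatorname{tail}(P)$. (The assumption on $v_*$ says exactly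 that $P_{[P]}=P$, and it can always be achieved by a lattice translation of $P$.) For a Minkowski summand $Q$ of a nonnegative multiple of $P$ with $\operatorname{tail}(Q)=\operatorname{tail}(P)$ and a vertex $v$ of $P$, let $v(Q)$ be the corresponding vertex of $Q$, i.e. $\operatorname{face}(Q,c)=\{v(Q)\}$ whenever $\operatorname{face}(P,c)=\{v\}$. Let $\kappa(Q)=(t(Q),s(Q))\in\mathbb R^r\oplus\mathbb R^p$, where $t_{vw}(Q)\ge 0$ is the dilation factor, $w(Q)-v(Q)=t_{vw}(Q)(w-v)$, and $s_v(Q)=0$ if $v(Q)\in N$, $s_v(Q)=1$ if $v(Q)\notin N$. A Minkowski decomposition $P=Q_0+\dots+Q_m$ is called lattice friendly if all $Q_i$ have the tail cone $\operatorname{tail}(P)$ and for every $c\in\operatorname{tail}(P)^\vee\cap M$ there is an index $\mu$ such that $\operatorname{face}(Q_i,c)$ contains a lattice point for all $i\neq\mu$. Theorem. Let $\xi_0,\dots,\xi_m\in\mathcal T_+(P)$ with $\xi_0+\dots+\xi_m=[P]$. Then the following are equivalent: (i) $\xi_0,\dots,\xi_m\in\mathcal T_{\mathbb Z}(P)$;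 (ii) for each vertex $w$ of $P$ and each $i\in\{0,\dots,m\}$ one has $w(P_{\xi_i})\notin N$ if and only if $w\notin N$ and $s_w(\xi_i)=1$; (iii) $P_{\xi_0}+\dots+P_{\xi_m}=P$, this decomposition is lattice friendly, and $\kappa(P_{\xi_i})=\xi_i$ for $i=0,\dots,m$. -/

import Mathlib

open scoped Pointwise

noncomputable section

namespace LatticeMinkowski

/-- The real vector space `N_ℝ = N ⊗ ℝ` of the lattice `N = ℤ^d`. -/
abbrev NR (d : ℕ) : Type := Fin d → ℝ

variable {d : ℕ}

/-- The lattice `N = ℤ^d` inside `N_ℝ = ℝ^d`. -/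
def latticePts (d : ℕ) : AddSubgroup (NR d) where
  carrier := {x | ∀ i, ∃ z : ℤ, x i = z}
  zero_mem' := fun _ => ⟨0, by simp⟩
  add_mem' := by
    intro a b ha hb i
    obtain ⟨z, hz⟩ := ha i
    obtain ⟨z', hz'⟩ := hb i
    exact ⟨z + z', by simp [hz, hz']⟩
  neg_mem' := by
    intro a ha i
    obtain ⟨z, hz⟩ := ha i
    exact ⟨-z, by simp [hz]⟩

/-- The pairing between linear forms and points. -/
def pairing (c a : NR d) : ℝ := ∑ i, c i * a i

/-- A rational polyhedron: the intersection of finitely many half-spaces given by linear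
inequalities with rational coefficients. -/
def IsRationalPolyhedron (P : Set (NR d)) : Prop :=
  ∃ (k : ℕ) (a : Fin k → Fin d → ℚ) (b : Fin k → ℚ),
    P = {x | ∀ j, (b j : ℝ) ≤ pairing (fun i => (a j i : ℝ)) x}

/-- The tail cone of `P`. -/
def tailCone (P : Set (NR d)) : Set (NR d) := {a | ∀ x ∈ P, a + x ∈ P}

/-- The dual cone of the tail cone of `P`. -/
def tailDual (P : Set (NR d)) : Set (NR d) := {c | ∀ a ∈ tailCone P, 0 ≤ pairing c a}

/-- `face Q c`: the points of `Q` at which the linear form `c` attains its minimum on `Q`. -/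
def face (Q : Set (NR d)) (c : NR d) : Set (NR d) :=
  {a | a ∈ Q ∧ ∀ b ∈ Q, pairing c a ≤ pairing c b}

/-- The vertices of `P`: the zero-dimensional faces. -/
def Vert (P : Set (NR d)) : Type := {v : NR d // ∃ c, face P c = {v}}

/-- The point of `N_ℝ` underlying a vertex. -/
def Vert.pt {P : Set (NR d)} (v : Vert P) : NR d := v.1

/-- The graph of vertices and compact edges of `P`: `v` and `w` are adjacent when the segment
`[v, w]` is a one-dimensional face of `P`. -/
def edgeGraph (P : Set (NR d)) : SimpleGraph (Vert P) where
  Adj v w := v ≠ w ∧ ∃ c, face P c = segment ℝ v.pt w.pt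
  symm := by
    constructor
    rintro v w ⟨hne, c, hc⟩
    exact ⟨hne.symm, c, by rw [hc, segment_symm]⟩
  loopless := ⟨fun _ h => h.1 rfl⟩

/-- The compact edges of `P` (unoriented). -/
abbrev CompactEdge (P : Set (NR d)) : Type := (edgeGraph P).edgeSet

/-- `ℝ^r ⊕ ℝ^p`, with one coordinate `t` per compact edge and one coordinate `s` per vertex. -/
abbrev Param (P : Set (NR d)) : Type := (CompactEdge P → ℝ) × (Vert P → ℝ)

/-- `t_{vw}` for adjacent vertices `v`, `w`. -/
def tCoord {P : Set (NR d)} (t : CompactEdge P → ℝ) {v w : Vert P}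
    (h : (edgeGraph P).Adj v w) : ℝ :=
  t ⟨s(v, w), h⟩

/-- `∑ t_e • (head e - tail e)` over the oriented edges `e` of a walk along compact edges. -/
def walkSum {P : Set (NR d)} (t : CompactEdge P → ℝ) {v w : Vert P}
    (p : (edgeGraph P).Walk v w) : NR d :=
  (p.darts.map fun e => tCoord t e.adj • (e.snd.pt - e.fst.pt)).sum

/-- `F` is a compact two-dimensional face of `P`. -/
def IsCompactTwoFace (P F : Set (NR d)) : Prop :=
  (∃ c, F = face P c) ∧ IsCompact F ∧ Module.finrank ℝ (vectorSpan ℝ F) = 2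

/-- The closing conditions along the compact 2-faces (the condition defining `V(P)`).  The cycles
of the edge graph that stay inside a 2-face `F` are the boundary of the polygon `F`, run through in
either direction and from any starting vertex. -/
def ClosingConditions (P : Set (NR d)) (t : CompactEdge P → ℝ) : Prop :=
  ∀ F, IsCompactTwoFace P F → ∀ (v : Vert P) (p : (edgeGraph P).Walk v v), p.IsCycle →
    (∀ u ∈ p.support, u.pt ∈ F) → walkSum t p = 0

/-- `g([v,w))`: the least positive integer `g` such that the affine line through `gv` and `gw`
contains lattice points. -/
def lineIndex (v w : NR d) : ℕ :=
  sInf {g : ℕ | 1 ≤ g ∧ ∃ x ∈ latticePts d, x ∈ affineSpan ℝ {(g : ℝ) • v, (g : ℝ) • w}}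

/-- The half-open segment `[v, w)`. -/
def halfOpen (v w : NR d) : Set (NR d) := AffineMap.lineMap v w '' Set.Ico (0 : ℝ) 1

/-- `[v, w)` is short: `g • [v, w)` contains at most `g - 1` lattice points,
where `g = g([v,w))`. -/
def IsShort (v w : NR d) : Prop :=
  ((lineIndex v w : ℝ) • halfOpen v w ∩ (latticePts d : Set (NR d))).encard + 1
    ≤ (lineIndex v w : ℕ∞)

/-- The vector space `T(P)`, as a subset of `ℝ^r ⊕ ℝ^p`. -/
def TSpace (P : Set (NR d)) : Set (Param P) :=
  {ξ | ClosingConditions P ξ.1 ∧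
    (∀ v : Vert P, v.pt ∈ latticePts d → ξ.2 v = 0) ∧
    (∀ v w : Vert P, (edgeGraph P).Adj v w →
      Disjoint (segment ℝ v.pt w.pt) (latticePts d : Set (NR d)) → ξ.2 v = ξ.2 w) ∧
    (∀ (v w : Vert P) (h : (edgeGraph P).Adj v w),
      IsShort v.pt w.pt → ξ.2 v = tCoord ξ.1 h)}

/-- The cone `T_+(P)`: the elements of `T(P)` with nonnegative coordinates. -/
def TPlus (P : Set (NR d)) : Set (Param P) :=
  {ξ | ξ ∈ TSpace P ∧ (∀ e, 0 ≤ ξ.1 e) ∧ ∀ v, 0 ≤ ξ.2 v}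

/-- The lattice `T_ℤ(P)` in `T(P)`. -/
def TInt (P : Set (NR d)) : Set (Param P) :=
  {ξ | ξ ∈ TSpace P ∧ (∀ v, ∃ z : ℤ, ξ.2 v = z) ∧
    ∀ (v w : Vert P) (h : (edgeGraph P).Adj v w),
      (tCoord ξ.1 h - ξ.2 v) • v.pt - (tCoord ξ.1 h - ξ.2 w) • w.pt ∈ latticePts d}

open Classical in
/-- The distinguished element `[P]`: all `t` are `1`, and `s_v` is `0` at lattice vertices and `1`
at the other vertices. -/
def distinguished (P : Set (NR d)) : Param P :=
  (fun _ => 1, fun v => if v.pt ∈ latticePts d then 0 else 1)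

open Classical in
/-- `ψ(ξ, v)` with respect to the reference vertex `vs`, computed along a chosen path from `vs`
to `v` of compact edges (the graph of compact edges of a polyhedron is connected, so the `else`
branch does not occur). -/
def psi (P : Set (NR d)) (vs : Vert P) (ξ : Param P) (v : Vert P) : NR d :=
  ξ.2 vs • vs.pt +
    if h : Nonempty ((edgeGraph P).Walk vs v) then walkSum ξ.1 (Classical.choice h) else 0

/-- The polyhedron `P_ξ = conv {ψ(ξ, v) : v ∈ Vert P} + tail P`. -/
def summand (P : Set (NR d)) (vs : Vert P) (ξ : Param P) : Set (NR d) :=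
  convexHull ℝ (Set.range (psi P vs ξ)) + tailCone P

/-- `v(Q)`: the vertex of the Minkowski summand `Q` of `P` that corresponds to the vertex `v` of
`P`, i.e. the point with `face Q c = {v(Q)}` for every `c` with `face P c = {v}`. -/
def vertexIn (P Q : Set (NR d)) (v : Vert P) : NR d :=
  Classical.epsilon fun q => ∀ c, face P c = {v.pt} → face Q c = {q}

/-- The dilation factor of the compact edge `e` of `P` inside the Minkowski summand `Q`. -/
def dilation (P Q : Set (NR d)) (e : CompactEdge P) : ℝ :=
  Classical.epsilon fun r => 0 ≤ r ∧ ∀ v w : Vert P, (e : Sym2 (Vert P)) = s(v, w) →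
    vertexIn P Q w - vertexIn P Q v = r • (w.pt - v.pt)

open Classical in
/-- The Kodaira-Spencer evaluation `κ(Q) = (t(Q), s(Q))` of a Minkowski summand `Q` of `P`. -/
def kodairaSpencer (P Q : Set (NR d)) : Param P :=
  (dilation P Q, fun v => if vertexIn P Q v ∈ latticePts d then 0 else 1)

/-- The polyhedra `Q 0, …, Q m` form a lattice friendly Minkowski decomposition of `P`. -/
def IsLatticeFriendly (P : Set (NR d)) {m : ℕ} (Q : Fin (m + 1) → Set (NR d)) : Prop :=
  ∑ i, Q i = P ∧ (∀ i, tailCone (Q i) = tailCone P) ∧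
    ∀ c : Fin d → ℤ, (fun j => (c j : ℝ)) ∈ tailDual P →
      ∃ μ : Fin (m + 1), ∀ i, i ≠ μ →
        (face (Q i) (fun j => (c j : ℝ)) ∩ (latticePts d : Set (NR d))).Nonempty

end LatticeMinkowski

end

/-!
The edge condition defining `T_ℤ(P)` says that `ψ(ξ, v) - s_v v` is constant modulo `N` along compact
edges. This difference is `0` at the reference vertex, so `ξ ∈ T_ℤ(P)` if and only if all `s_v` are
integers and `ψ(ξ, v) ≡ s_v v` modulo `N` (`mem_TInt_iff`). Moreover `ψ(ξ, v)` is the vertex of `P_ξ`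
that corresponds to `v` (`vertexIn_summand`), and `∑ ψ(ξ_i, v) = v` (`sum_psi`). At vertices
`v ∈ N` all `s_v(ξ_i)` vanish, and each of the conditions makes all `ψ(ξ_i, v)` lattice points. At
vertices `v ∉ N` the `s_v(ξ_i)` are nonnegative with sum `1` and not all `ψ(ξ_i, v)` are lattice points,
so each of the conditions says that exactly one `s_v(ξ_i)` is `1` and that `ψ(ξ_i, v)` is a lattice
point for all other `i`. A linear form `c` that is
nonnegative on the tail cone is minimal on `P` at some vertex `v`, and then on every `P_ξ` at `ψ(ξ, v)`
(`psi_mem_face_summand`), so the decomposition is lattice friendly.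

What needs work is polyhedral geometry. The points `ψ(ξ, v)` are independent of the path because the
closing conditions along the compact 2-faces integrate to a potential on the vertices
(`ClosingConditions.exists_potential`). To see this, orient the edges by a linear form `c` that
separates the vertices and is bounded below on `P`, and extend the potential upwards from the lowest
vertex, as in Newman's diamond lemma. Two descending edges at `u` in a common 2-face lead to the same
value at `u`, as this 2-face is compact and the two edges close up to a cycle below `u`
(`potential_eq_of_twoFace`). Arbitrary descending edges at `u` are connected through such pairs, since
the part `c < 0` of the edge graph of the vertex figure is connected (`IsPoly.exists_walk_le`). Both
this and the comparison of the faces of `P` and `P_ξ` rest on the simplex method: a vertex that is not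
lowest has a lower neighbour (`IsPoly.exists_adj_lt`).
-/

open scoped Pointwise

namespace LatticeMinkowski

open Filter Topology

/-! ### The pairing -/

section Pairing

variable {d : ℕ}

@[simp] lemma pairing_add_right (c x y : NR d) :
    pairing c (x + y) = pairing c x + pairing c y := dotProduct_add c x y

@[simp] lemma pairing_sub_right (c x y : NR d) :
    pairing c (x - y) = pairing c x - pairing c y := dotProduct_sub c x y

@[simp] lemma pairing_neg_right (c x : NR d) : pairing c (-x) = -pairing c x :=
  dotProduct_neg c x

@[simp] lemma pairing_smul_right (c x : NR d) (r : ℝ) :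
    pairing c (r • x) = r * pairing c x := dotProduct_smul r c x

@[simp] lemma pairing_zero_right (c : NR d) : pairing c 0 = 0 := dotProduct_zero c

@[simp] lemma pairing_add_left (c c' x : NR d) :
    pairing (c + c') x = pairing c x + pairing c' x := add_dotProduct c c' x

@[simp] lemma pairing_sub_left (c c' x : NR d) :
    pairing (c - c') x = pairing c x - pairing c' x := sub_dotProduct c c' x

@[simp] lemma pairing_neg_left (c x : NR d) : pairing (-c) x = -pairing c x :=
  neg_dotProduct c x

@[simp] lemma pairing_smul_left (c x : NR d) (r : ℝ) :
    pairing (r • c) x = r * pairing c x := smul_dotProduct r c x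

lemma pairing_sum_left {ι : Type*} (s : Finset ι) (c : ι → NR d) (x : NR d) :
    pairing (∑ i ∈ s, c i) x = ∑ i ∈ s, pairing (c i) x := sum_dotProduct s c x

lemma pairing_sum_right {ι : Type*} (s : Finset ι) (c : NR d) (x : ι → NR d) :
    pairing c (∑ i ∈ s, x i) = ∑ i ∈ s, pairing c (x i) := dotProduct_sum c s x

lemma continuous_pairing (c : NR d) : Continuous (pairing c) := by
  unfold pairing
  fun_prop

lemma convex_halfSpace_pairing (c : NR d) (r : ℝ) : Convex ℝ {x | r ≤ pairing c x} := by
  intro x hx y hy a b ha hb hab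
  simp only [Set.mem_ofPred_eq, pairing_add_right, pairing_smul_right] at *
  calc r = a * r + b * r := by rw [← add_mul, hab, one_mul]
    _ ≤ _ := add_le_add (mul_le_mul_of_nonneg_left hx ha) (mul_le_mul_of_nonneg_left hy hb)

end Pairing

/-! ### Polyhedra, their tail cones and their vertices -/

section Polyhedra

variable {d : ℕ} {P : Set (NR d)}

/-- A polyhedron: a finite intersection of half-spaces, without any rationality. This class is
closed under passing to vertex figures. -/
def IsPoly (P : Set (NR d)) : Prop :=
  ∃ (ι : Type) (_ : Finite ι) (a : ι → NR d) (b : ι → ℝ), P = {x | ∀ j, b j ≤ pairing (a j) x}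

lemma IsRationalPolyhedron.isPoly (hP : IsRationalPolyhedron P) : IsPoly P := by
  obtain ⟨k, a, b, rfl⟩ := hP
  exact ⟨Fin k, inferInstance, fun j i => (a j i : ℝ), fun j => (b j : ℝ), rfl⟩

lemma IsPoly.convex (hP : IsPoly P) : Convex ℝ P := by
  obtain ⟨ι, _, a, b, rfl⟩ := hP
  rw [Set.ofPred_forall]
  exact convex_iInter fun j => convex_halfSpace_pairing (a j) (b j)

lemma IsPoly.isClosed (hP : IsPoly P) : IsClosed P := by
  obtain ⟨ι, _, a, b, rfl⟩ := hP
  rw [Set.ofPred_forall]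
  exact isClosed_iInter fun j => isClosed_le continuous_const (continuous_pairing (a j))

/-- Directions along which no active inequality decreases are feasible. -/
lemma eventually_add_smul_mem {ι : Type} [Finite ι] {a : ι → NR d} {b : ι → ℝ} {x y : NR d}
    (hx : ∀ j, b j ≤ pairing (a j) x) (hy : ∀ j, pairing (a j) x = b j → 0 ≤ pairing (a j) y) :
    ∀ᶠ ε in 𝓝[>] (0 : ℝ), ∀ j, b j ≤ pairing (a j) (x + ε • y) := by
  rw [eventually_all]
  intro j
  rcases (hx j).eq_or_lt with h | h
  · filter_upwards [self_mem_nhdsWithin] with ε hε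
    have := mul_nonneg (le_of_lt hε) (hy j h.symm)
    simp only [pairing_add_right, pairing_smul_right]
    linarith
  · have hc : Continuous fun ε : ℝ => pairing (a j) (x + ε • y) := by
      simp only [pairing_add_right, pairing_smul_right]
      fun_prop
    have h0 : b j < pairing (a j) (x + (0 : ℝ) • y) := by simpa using h
    exact (((hc.tendsto 0).eventually (lt_mem_nhds h0)).filter_mono nhdsWithin_le_nhds).mono
      fun _ => le_of_lt

/-- The ratio test: moving from `x` in a direction that eventually leaves the polyhedron, one
meets a first inequality that becomes active. -/
lemma exists_blocking {ι : Type} [Finite ι] {a : ι → NR d} {b : ι → ℝ} {x y : NR d}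
    (hx : ∀ j, b j ≤ pairing (a j) x) (hy : ∃ j, pairing (a j) y < 0) :
    ∃ s : ℝ, 0 ≤ s ∧ (∀ j, b j ≤ pairing (a j) (x + s • y)) ∧
      ∃ j, pairing (a j) y < 0 ∧ pairing (a j) (x + s • y) = b j := by
  obtain ⟨j, hj, hmin⟩ := Set.exists_min_image {j | pairing (a j) y < 0}
    (fun j => (pairing (a j) x - b j) / (-pairing (a j) y)) (Set.toFinite _) hy
  have hj' : 0 < -pairing (a j) y := neg_pos.2 hj
  have hs : 0 ≤ (pairing (a j) x - b j) / (-pairing (a j) y) :=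
    div_nonneg (sub_nonneg.2 (hx j)) hj'.le
  refine ⟨_, hs, fun i => ?_, j, hj, ?_⟩
  · simp only [pairing_add_right, pairing_smul_right]
    rcases le_or_gt 0 (pairing (a i) y) with hi | hi
    · have := mul_nonneg hs hi
      linarith [hx i]
    · have := hmin i hi
      rw [le_div_iff₀ (neg_pos.2 hi)] at this
      linarith
  · simp only [pairing_add_right, pairing_smul_right]
    have : (pairing (a j) x - b j) / (-pairing (a j) y) * (-pairing (a j) y)
        = pairing (a j) x - b j := div_mul_cancel₀ _ hj'.ne'
    linarith

lemma tailCone_add {y z : NR d} (hy : y ∈ tailCone P) (hz : z ∈ tailCone P) :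
    y + z ∈ tailCone P := fun x hx => by
  rw [add_assoc]
  exact hy _ (hz x hx)

lemma zero_mem_tailCone : (0 : NR d) ∈ tailCone P := fun x hx => by simpa using hx

/-- A linear form that is bounded below on a nonempty set is nonnegative on the tail cone. -/
lemma pairing_nonneg_of_mem_tailCone {c y : NR d} {B : ℝ} (hne : P.Nonempty)
    (hB : ∀ x ∈ P, B ≤ pairing c x) (hy : y ∈ tailCone P) : 0 ≤ pairing c y := by
  obtain ⟨x, hx⟩ := hne
  have hn : ∀ n : ℕ, (n : ℝ) • y + x ∈ P := by
    intro n
    induction n with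
    | zero => simpa using hx
    | succ n ih =>
      have := hy _ ih
      rwa [Nat.cast_succ, add_smul, one_smul, add_comm ((n : ℝ) • y), add_assoc]
  by_contra hlt
  push Not at hlt
  obtain ⟨n, hn'⟩ := exists_nat_gt ((pairing c x - B) / (-pairing c y))
  rw [div_lt_iff₀ (neg_pos.2 hlt)] at hn'
  have := hB _ (hn n)
  simp only [pairing_add_right, pairing_smul_right] at this
  linarith

lemma mem_tailCone_setOf {ι : Type*} {a : ι → NR d} {b : ι → ℝ}
    (hne : {x | ∀ j, b j ≤ pairing (a j) x}.Nonempty) {y : NR d} :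
    y ∈ tailCone {x | ∀ j, b j ≤ pairing (a j) x} ↔ ∀ j, 0 ≤ pairing (a j) y := by
  constructor
  · intro hy j
    exact pairing_nonneg_of_mem_tailCone hne (fun x hx => hx j) hy
  · intro hy x hx j
    rw [pairing_add_right]
    linarith [hy j, hx j]

lemma IsPoly.smul_mem_tailCone (hP : IsPoly P) (hne : P.Nonempty) {y : NR d}
    (hy : y ∈ tailCone P) {r : ℝ} (hr : 0 ≤ r) : r • y ∈ tailCone P := by
  obtain ⟨ι, _, a, b, rfl⟩ := hP
  rw [mem_tailCone_setOf hne] at hy ⊢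
  intro j
  rw [pairing_smul_right]
  exact mul_nonneg hr (hy j)

lemma IsPoly.convex_tailCone (hP : IsPoly P) (hne : P.Nonempty) : Convex ℝ (tailCone P) :=
  fun _ hx _ hy _ _ ha hb _ =>
    tailCone_add (hP.smul_mem_tailCone hne hx ha) (hP.smul_mem_tailCone hne hy hb)

lemma face_subset (P : Set (NR d)) (c : NR d) : face P c ⊆ P := fun _ h => h.1

lemma Vert.mem (v : Vert P) : v.pt ∈ P := by
  obtain ⟨c, hc⟩ := v.2
  have : v.pt ∈ face P c := by rw [hc]; rfl
  exact this.1

@[ext] lemma Vert.ext {v w : Vert P} (h : v.pt = w.pt) : v = w := Subtype.ext h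

lemma pairing_lt_of_face_eq {c u x : NR d} (h : face P c = {u}) (hx : x ∈ P) (hne : x ≠ u) :
    pairing c u < pairing c x := by
  have hu : u ∈ face P c := by rw [h]; rfl
  refine (hu.2 x hx).lt_of_ne fun heq => hne ?_
  have : x ∈ face P c := ⟨hx, fun y hy => heq ▸ hu.2 y hy⟩
  rwa [h] at this

lemma face_eq_singleton {c u : NR d} (hu : u ∈ P)
    (h : ∀ x ∈ P, x ≠ u → pairing c u < pairing c x) : face P c = {u} := by
  ext x
  constructor
  · intro hx
    by_contra hne
    exact absurd (hx.2 u hu) (not_le.2 (h x hx.1 hne))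
  · rintro rfl
    refine ⟨hu, fun y hy => ?_⟩
    rcases eq_or_ne y x with rfl | hne
    · exact le_rfl
    · exact (h y hy hne).le

/-- Exposed points are extreme. -/
lemma eq_zero_of_face_eq {c u y : NR d} (h : face P c = {u}) (h1 : u + y ∈ P) (h2 : u - y ∈ P) :
    y = 0 := by
  by_contra hy
  have h1' := pairing_lt_of_face_eq h h1 (by simpa using hy)
  have h2' := pairing_lt_of_face_eq h h2 (by simpa using hy)
  simp only [pairing_add_right, pairing_sub_right] at h1' h2'
  linarith

/-- Extreme points of a polyhedron are exposed, namely by the sum of the active linear forms. -/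
lemma IsPoly.exists_face_eq_singleton (hP : IsPoly P) {x : NR d} (hx : x ∈ P)
    (hext : ∀ y, x + y ∈ P → x - y ∈ P → y = 0) : ∃ c, face P c = {x} := by
  classical
  obtain ⟨ι, _, a, b, rfl⟩ := hP
  have := Fintype.ofFinite ι
  let s : Finset ι := Finset.univ.filter fun j => pairing (a j) x = b j
  have hmem : ∀ j, j ∈ s ↔ pairing (a j) x = b j := fun j => by simp [s]
  refine ⟨∑ j ∈ s, a j, face_eq_singleton hx fun z hz hne => ?_⟩
  have hle : ∀ j ∈ s, pairing (a j) x ≤ pairing (a j) z :=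
    fun j hj => ((hmem j).1 hj).trans_le (hz j)
  rw [pairing_sum_left, pairing_sum_left]
  refine (Finset.sum_le_sum hle).lt_of_ne fun heq => hne ?_
  -- now all active inequalities of `x` are active at `z`, so that `x ± ε (z - x)` lies in `P`
  have heq' := (Finset.sum_eq_sum_iff_of_le hle).1 heq
  have h0 : ∀ j, pairing (a j) x = b j → pairing (a j) (z - x) = 0 := fun j hj => by
    rw [pairing_sub_right, heq' j ((hmem j).2 hj), sub_self]
  have e1 := eventually_add_smul_mem (y := z - x) hx fun j hj => (h0 j hj).ge
  have e2 := eventually_add_smul_mem (y := -(z - x)) hx fun j hj => by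
    rw [pairing_neg_right, h0 j hj, neg_zero]
  obtain ⟨ε, ⟨h1, h2⟩, hε⟩ := ((e1.and e2).and self_mem_nhdsWithin).exists
  have := hext (ε • (z - x)) h1 (by rw [sub_eq_add_neg, ← smul_neg]; exact h2)
  exact sub_eq_zero.1 ((smul_eq_zero.1 this).resolve_left (ne_of_gt hε))

/-- A polyhedron has finitely many vertices, as a vertex is determined by its active
inequalities. -/
lemma IsPoly.finite_vert (hP : IsPoly P) : Finite (Vert P) := by
  obtain ⟨ι, _, a, b, rfl⟩ := hP
  refine Finite.of_injective
    (fun v : Vert _ => {j | pairing (a j) v.pt = b j}) fun v w hvw => ?_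
  have hvw' : ∀ j, pairing (a j) v.pt = b j → pairing (a j) w.pt = b j := fun j hj =>
    (Set.ext_iff.1 hvw j).1 hj
  have h0 : ∀ j, pairing (a j) v.pt = b j → pairing (a j) (w.pt - v.pt) = 0 := fun j hj => by
    rw [pairing_sub_right, hvw' j hj, hj, sub_self]
  have e1 := eventually_add_smul_mem (y := w.pt - v.pt) v.mem fun j hj => (h0 j hj).ge
  have e2 := eventually_add_smul_mem (y := -(w.pt - v.pt)) v.mem fun j hj => by
    rw [pairing_neg_right, h0 j hj, neg_zero]
  obtain ⟨ε, ⟨h1, h2⟩, hε⟩ := ((e1.and e2).and self_mem_nhdsWithin).exists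
  obtain ⟨c, hc⟩ := v.2
  have := eq_zero_of_face_eq (y := ε • (w.pt - v.pt)) hc h1
    (by rw [sub_eq_add_neg, ← smul_neg]; exact h2)
  exact Vert.ext (sub_eq_zero.1 ((smul_eq_zero.1 this).resolve_left (ne_of_gt hε))).symm

/-- `P` contains no line. -/
def IsPointed (P : Set (NR d)) : Prop := ∀ y ∈ tailCone P, -y ∈ tailCone P → y = 0

lemma Vert.isPointed (v : Vert P) : IsPointed P := by
  intro y h1 h2
  obtain ⟨c, hc⟩ := v.2
  refine eq_zero_of_face_eq (y := y) hc ?_ ?_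
  · rw [add_comm]; exact h1 _ v.mem
  · rw [sub_eq_neg_add]; exact h2 _ v.mem

/-- A pointed polyhedron is the sum of the convex hull of its vertices and of its tail cone. A
point that is not a vertex is moved along a line in its minimal face until another inequality
becomes active. -/
lemma IsPoly.subset_convexHull_add_tailCone (hP : IsPoly P) (hpt : IsPointed P) :
    P ⊆ convexHull ℝ (Set.range (Vert.pt : Vert P → NR d)) + tailCone P := by
  intro x hx
  have hP' := hP
  obtain ⟨ι, _, a, b, hab⟩ := hP
  have hne : P.Nonempty := ⟨x, hx⟩
  have htail : ∀ y, y ∈ tailCone P ↔ ∀ j, 0 ≤ pairing (a j) y := fun y => by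
    subst hab
    exact mem_tailCone_setOf hne
  have hmem : ∀ y, y ∈ P ↔ ∀ j, b j ≤ pairing (a j) y := fun y => by rw [hab]; rfl
  have hconv : Convex ℝ (convexHull ℝ (Set.range (Vert.pt : Vert P → NR d)) + tailCone P) :=
    (convex_convexHull ℝ _).add (hP'.convex_tailCone hne)
  induction hn : {j | pairing (a j) x ≠ b j}.ncard using Nat.strong_induction_on
    generalizing x with
  | _ n ih =>
    by_cases hext : ∀ y, x + y ∈ P → x - y ∈ P → y = 0
    · obtain ⟨c, hc⟩ := hP'.exists_face_eq_singleton hx hext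
      exact ⟨x, subset_convexHull ℝ _ ⟨⟨x, c, hc⟩, rfl⟩, 0, zero_mem_tailCone, add_zero x⟩
    push Not at hext
    obtain ⟨y, h1, h2, hy0⟩ := hext
    have hact : ∀ j, pairing (a j) x = b j → pairing (a j) y = 0 := fun j hj => by
      have h1' := (hmem _).1 h1 j
      have h2' := (hmem _).1 h2 j
      simp only [pairing_add_right, pairing_sub_right] at h1' h2'
      linarith
    have step : ∀ z : NR d, (∀ j, pairing (a j) x = b j → pairing (a j) z = 0) →
        z ∉ tailCone P → ∃ s : ℝ, 0 ≤ s ∧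
          x + s • z ∈ convexHull ℝ (Set.range (Vert.pt : Vert P → NR d)) + tailCone P := by
      intro z hz hzt
      rw [htail] at hzt
      push Not at hzt
      obtain ⟨s, hs, hsP, j, hj, hjs⟩ := exists_blocking ((hmem x).1 hx) hzt
      refine ⟨s, hs, ih _ ?_ ((hmem _).2 hsP) rfl⟩
      rw [← hn]
      refine Set.ncard_lt_ncard ⟨fun i hi hi' => hi ?_, fun hsub => ?_⟩ (Set.toFinite _)
      · rw [pairing_add_right, pairing_smul_right, hz i hi', hi', mul_zero, add_zero]
      · exact hsub (fun h => hj.ne (hz j h) : pairing (a j) x ≠ b j) hjs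
    have absorb : ∀ z : NR d, ∀ s : ℝ, 0 ≤ s → -z ∈ tailCone P →
        x + s • z ∈ convexHull ℝ (Set.range (Vert.pt : Vert P → NR d)) + tailCone P →
        x ∈ convexHull ℝ (Set.range (Vert.pt : Vert P → NR d)) + tailCone P := by
      rintro z s hs hz ⟨p, hp, q, hq, hpq⟩
      refine ⟨p, hp, q + s • -z, tailCone_add hq (hP'.smul_mem_tailCone hne hz hs), ?_⟩
      have : p + q = x + s • z := hpq
      show p + (q + s • -z) = x
      rw [← add_assoc, this, smul_neg, add_neg_cancel_right]
    by_cases hyt : y ∈ tailCone P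
    · have hyt' : -y ∉ tailCone P := fun h => hy0 (hpt y hyt h)
      obtain ⟨s, hs, hm⟩ := step (-y) (fun j hj => by rw [pairing_neg_right, hact j hj, neg_zero])
        hyt'
      exact absorb (-y) s hs (by rwa [neg_neg]) hm
    obtain ⟨s, hs, hm⟩ := step y hact hyt
    by_cases hyt' : -y ∈ tailCone P
    · exact absorb y s hs hyt' hm
    obtain ⟨s', hs', hm'⟩ := step (-y)
      (fun j hj => by rw [pairing_neg_right, hact j hj, neg_zero]) hyt'
    rcases hs.eq_or_lt with rfl | hs
    · simpa using hm
    refine hconv.segment_subset hm hm' ?_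
    have hpos : 0 < s + s' := by linarith
    refine ⟨s' / (s + s'), s / (s + s'), by positivity, by positivity, by field_simp; ring, ?_⟩
    rw [smul_add, smul_add, add_add_add_comm, ← add_smul, smul_neg, smul_neg, smul_smul, smul_smul,
      ← sub_eq_add_neg, ← sub_smul]
    rw [show s' / (s + s') + s / (s + s') = 1 by field_simp; ring,
      show s' / (s + s') * s - s / (s + s') * s' = 0 by ring]
    simp

/-- A linear form that is nonnegative on the tail cone attains its minimum at a vertex. -/
lemma IsPoly.exists_vert_le (hP : IsPoly P) (hpt : IsPointed P) (hne : P.Nonempty) {c : NR d}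
    (hc : c ∈ tailDual P) : ∃ v : Vert P, ∀ x ∈ P, pairing c v.pt ≤ pairing c x := by
  have := hP.finite_vert
  have hsub := hP.subset_convexHull_add_tailCone hpt
  have : Nonempty (Vert P) := by
    obtain ⟨x, hx⟩ := hne
    obtain ⟨p, hp, -⟩ := hsub hx
    obtain ⟨-, v, -⟩ := convexHull_nonempty_iff.1 ⟨p, hp⟩
    exact ⟨v⟩
  obtain ⟨v, hv⟩ := Finite.exists_min fun v : Vert P => pairing c v.pt
  refine ⟨v, fun x hx => ?_⟩
  obtain ⟨p, hp, q, hq, rfl⟩ := hsub hx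
  have h1 : pairing c v.pt ≤ pairing c p :=
    convexHull_min (s := Set.range Vert.pt) (by rintro _ ⟨w, rfl⟩; exact hv w)
      (convex_halfSpace_pairing c (pairing c v.pt)) hp
  have h2 := hc q hq
  show _ ≤ pairing c (p + q)
  rw [pairing_add_right]
  linarith

lemma mem_tailDual_of_forall_le {c u : NR d} (hu : u ∈ P)
    (h : ∀ x ∈ P, pairing c u ≤ pairing c x) : c ∈ tailDual P :=
  fun _ hy => pairing_nonneg_of_mem_tailCone ⟨u, hu⟩ h hy

end Polyhedra

/-! ### Vertex figures and descending edges -/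

section VertexFigure

variable {d : ℕ} {P : Set (NR d)}

/-- The vertex figure of `P` at the vertex `u`: the slice `h = 1` of the cone of feasible
directions at `u`. It is meant for a linear form `h` with `face P h = {u}`. Its vertices correspond
to the edges of `P` at `u`, its edges to the 2-faces of `P` at `u`. -/
def vertexFigure (P : Set (NR d)) (u h : NR d) : Set (NR d) :=
  {y | (∃ ε : ℝ, 0 < ε ∧ u + ε • y ∈ P) ∧ pairing h y = 1}

lemma IsPoly.exists_feasible_iff (hP : IsPoly P) {u : NR d} (hu : u ∈ P) :
    ∃ (ι : Type) (_ : Finite ι) (a : ι → NR d),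
      ∀ y, (∃ ε : ℝ, 0 < ε ∧ u + ε • y ∈ P) ↔ ∀ j, 0 ≤ pairing (a j) y := by
  obtain ⟨ι, _, a, b, rfl⟩ := hP
  refine ⟨{j // pairing (a j) u = b j}, inferInstance, fun j => a j, fun y => ⟨?_, fun hy => ?_⟩⟩
  · rintro ⟨ε, hε, hm⟩ ⟨j, hj⟩
    have := hm j
    rw [pairing_add_right, pairing_smul_right, hj] at this
    exact nonneg_of_mul_nonneg_right (by linarith) hε
  · obtain ⟨ε, h1, h2⟩ := ((eventually_add_smul_mem (y := y) hu
      fun j hj => hy ⟨j, hj⟩).and self_mem_nhdsWithin).exists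
    exact ⟨ε, h2, h1⟩

lemma IsPoly.isPoly_vertexFigure (hP : IsPoly P) {u : NR d} (hu : u ∈ P) (h : NR d) :
    IsPoly (vertexFigure P u h) := by
  obtain ⟨ι, _, a, ha⟩ := hP.exists_feasible_iff hu
  refine ⟨ι ⊕ Bool, inferInstance, Sum.elim a fun t => if t then h else -h,
    Sum.elim (fun _ => 0) fun t => if t then 1 else -1, ?_⟩
  ext y
  simp only [vertexFigure, ha, Set.mem_ofPred_eq, Sum.forall, Sum.elim_inl,
    Sum.elim_inr, Bool.forall_bool, if_true, Bool.false_eq_true, if_false, pairing_neg_left,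
    neg_le_neg_iff]
  rw [← le_antisymm_iff]

lemma pairing_pos_of_feasible {u h y : NR d} (hu : face P h = {u})
    (hy : ∃ ε : ℝ, 0 < ε ∧ u + ε • y ∈ P) (hy0 : y ≠ 0) : 0 < pairing h y := by
  obtain ⟨ε, hε, hm⟩ := hy
  have := pairing_lt_of_face_eq hu hm (by simp [hε.ne', hy0])
  rw [pairing_add_right, pairing_smul_right] at this
  exact pos_of_mul_pos_right (by linarith) hε.le

lemma IsPoly.tailCone_vertexFigure (hP : IsPoly P) {u h : NR d} (hu : face P h = {u})
    (hne : (vertexFigure P u h).Nonempty) {z : NR d}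
    (hz : z ∈ tailCone (vertexFigure P u h)) : z = 0 := by
  have huP : u ∈ P := face_subset P h (by rw [hu]; rfl)
  obtain ⟨ι, _, a, ha⟩ := hP.exists_feasible_iff huP
  by_contra hz0
  have hfeas : ∃ ε : ℝ, 0 < ε ∧ u + ε • z ∈ P := (ha z).2 fun j =>
    pairing_nonneg_of_mem_tailCone (B := 0) hne (fun x hx => (ha x).1 hx.1 j) hz
  have hpos := pairing_pos_of_feasible hu hfeas hz0
  obtain ⟨k, hk⟩ := hne
  have h1 := (hz k hk).2
  rw [pairing_add_right, hk.2] at h1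
  linarith

lemma IsPoly.isPointed_vertexFigure (hP : IsPoly P) {u h : NR d} (hu : face P h = {u})
    (hne : (vertexFigure P u h).Nonempty) :
    IsPointed (vertexFigure P u h) :=
  fun _ hz _ => hP.tailCone_vertexFigure hu hne hz

lemma IsPoly.mem_tailDual_vertexFigure (hP : IsPoly P) {u h : NR d} (hu : face P h = {u})
    (hne : (vertexFigure P u h).Nonempty) (c : NR d) :
    c ∈ tailDual (vertexFigure P u h) := fun z hz => by
  rw [hP.tailCone_vertexFigure hu hne hz, pairing_zero_right]

lemma smul_mem_vertexFigure {u h y : NR d} (hu : face P h = {u})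
    (hy : ∃ ε : ℝ, 0 < ε ∧ u + ε • y ∈ P) (hy0 : y ≠ 0) :
    (pairing h y)⁻¹ • y ∈ vertexFigure P u h := by
  have hpos := pairing_pos_of_feasible hu hy hy0
  obtain ⟨ε, hε, hm⟩ := hy
  refine ⟨⟨ε * pairing h y, by positivity, ?_⟩, ?_⟩
  · rwa [smul_smul, mul_assoc, mul_inv_cancel₀ hpos.ne', mul_one]
  · rw [pairing_smul_right, inv_mul_cancel₀ hpos.ne']

lemma feasible_sub {u x : NR d} (hx : x ∈ P) : ∃ ε : ℝ, 0 < ε ∧ u + ε • (x - u) ∈ P :=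
  ⟨1, one_pos, by rwa [one_smul, add_sub_cancel]⟩

/-- A face of the vertex figure, cut out by `g` and containing `r`, spans a face of the cone of
feasible directions, which is cut out by `g - ⟨g, r⟩ h`. -/
lemma pairing_nonneg_of_feasible {u h g r y : NR d} (hu : face P h = {u})
    (hr : r ∈ face (vertexFigure P u h) g) (hy : ∃ ε : ℝ, 0 < ε ∧ u + ε • y ∈ P) :
    0 ≤ pairing (g - pairing g r • h) y := by
  rcases eq_or_ne y 0 with rfl | hy0
  · simp
  have hpos := pairing_pos_of_feasible hu hy hy0
  have := hr.2 _ (smul_mem_vertexFigure hu hy hy0)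
  rw [pairing_smul_right, inv_mul_eq_div, le_div_iff₀ hpos] at this
  rw [pairing_sub_left, pairing_smul_left]
  linarith

lemma smul_mem_face_vertexFigure {u h g r y : NR d} (hu : face P h = {u})
    (hr : r ∈ face (vertexFigure P u h) g) (hy : ∃ ε : ℝ, 0 < ε ∧ u + ε • y ∈ P) (hy0 : y ≠ 0)
    (h0 : pairing (g - pairing g r • h) y = 0) :
    (pairing h y)⁻¹ • y ∈ face (vertexFigure P u h) g := by
  have hpos := pairing_pos_of_feasible hu hy hy0
  refine ⟨smul_mem_vertexFigure hu hy hy0, fun z hz => ?_⟩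
  rw [pairing_sub_left, pairing_smul_left, sub_eq_zero] at h0
  rw [pairing_smul_right, h0, mul_comm (pairing g r), inv_mul_cancel_left₀ hpos.ne']
  exact hr.2 z hz

lemma mem_face_iff_of_vertexFigure {u h g r x : NR d} (hu : face P h = {u})
    (hr : r ∈ face (vertexFigure P u h) g) :
    x ∈ face P (g - pairing g r • h) ↔ x ∈ P ∧ pairing (g - pairing g r • h) (x - u) = 0 := by
  have huP : u ∈ P := face_subset P h (by rw [hu]; rfl)
  have hnn : ∀ z ∈ P, 0 ≤ pairing (g - pairing g r • h) (z - u) := fun z hz =>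
    pairing_nonneg_of_feasible hu hr (feasible_sub hz)
  constructor
  · intro hx
    refine ⟨hx.1, le_antisymm ?_ (hnn x hx.1)⟩
    rw [pairing_sub_right]
    linarith [hx.2 u huP]
  · rintro ⟨hx, h0⟩
    refine ⟨hx, fun z hz => ?_⟩
    have := hnn z hz
    rw [pairing_sub_right] at this h0
    linarith

/-- A vertex of the vertex figure in a descending direction spans a compact edge. -/
lemma IsPoly.exists_adj_of_vertexFigure (hP : IsPoly P) {u : Vert P} {h g r c : NR d}
    (hu : face P h = {u.pt}) (hr : face (vertexFigure P u.pt h) g = {r})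
    (hc : c ∈ tailDual P) (hcr : pairing c r < 0) :
    ∃ w : Vert P, (edgeGraph P).Adj u w ∧ ∃ s : ℝ, 0 < s ∧ w.pt = u.pt + s • r := by
  have hr' : r ∈ face (vertexFigure P u.pt h) g := by rw [hr]; rfl
  have hhr : pairing h r = 1 := hr'.1.2
  have hr0 : r ≠ 0 := by rintro rfl; simp at hhr
  set f := g - pairing g r • h with hf
  have hfr : pairing f r = 0 := by
    rw [hf, pairing_sub_left, pairing_smul_left, hhr, mul_one, sub_self]
  obtain ⟨v, hv⟩ := hP.exists_vert_le u.isPointed ⟨_, u.mem⟩ hc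
  -- the endpoint of the edge is the last point of `P` on the ray spanned by `r`
  have hcl : IsClosed {s : ℝ | 0 ≤ s ∧ u.pt + s • r ∈ P} :=
    isClosed_Ici.inter (hP.isClosed.preimage (by fun_prop))
  have hbd : BddAbove {s : ℝ | 0 ≤ s ∧ u.pt + s • r ∈ P} := by
    refine ⟨(pairing c u.pt - pairing c v.pt) / (-pairing c r), fun s hs => ?_⟩
    rw [le_div_iff₀ (neg_pos.2 hcr)]
    have := hv _ hs.2
    rw [pairing_add_right, pairing_smul_right] at this
    linarith
  obtain ⟨ε, hε, hεP⟩ := hr'.1.1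
  have hmem := hcl.csSup_mem ⟨ε, hε.le, hεP⟩ hbd
  set s := sSup {s : ℝ | 0 ≤ s ∧ u.pt + s • r ∈ P} with hs
  have hs0 : 0 < s := hε.trans_le (le_csSup hbd ⟨hε.le, hεP⟩)
  have hface : face P f = segment ℝ u.pt (u.pt + s • r) := by
    ext x
    rw [mem_face_iff_of_vertexFigure hu hr', segment_eq_image']
    constructor
    · rintro ⟨hx, h0⟩
      rcases eq_or_ne x u.pt with rfl | hxu
      · exact ⟨0, by simp, by simp⟩
      have hxu' := sub_ne_zero.2 hxu
      have hpos := pairing_pos_of_feasible hu (feasible_sub hx) hxu'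
      have hxr : (pairing h (x - u.pt))⁻¹ • (x - u.pt) = r := by
        have := smul_mem_face_vertexFigure hu hr' (feasible_sub hx) hxu' h0
        rwa [hr] at this
      have hxr' : pairing h (x - u.pt) • r = x - u.pt := by
        rw [← hxr, smul_inv_smul₀ hpos.ne']
      have hle : pairing h (x - u.pt) ≤ s :=
        le_csSup hbd ⟨hpos.le, by rw [hxr', add_sub_cancel]; exact hx⟩
      refine ⟨pairing h (x - u.pt) / s, ⟨by positivity, (div_le_one hs0).2 hle⟩, ?_⟩
      simp only [add_sub_cancel_left, smul_smul]
      rw [div_mul_cancel₀ _ hs0.ne', hxr', add_sub_cancel]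
    · rintro ⟨θ, hθ, rfl⟩
      refine ⟨hP.convex.segment_subset u.mem hmem.2 ?_, ?_⟩
      · rw [segment_eq_image']
        exact ⟨θ, hθ, rfl⟩
      · simp only [add_sub_cancel_left, pairing_smul_right]
        rw [← hf, hfr, mul_zero, mul_zero]
  have hwv : ∃ c, face P c = {u.pt + s • r} := by
    refine hP.exists_face_eq_singleton hmem.2 fun y h1 h2 => ?_
    have hw : u.pt + s • r ∈ face P f := by rw [hface]; exact right_mem_segment ℝ _ _
    have hfy : pairing f y = 0 := by
      have a1 := hw.2 _ h1
      have a2 := hw.2 _ h2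
      simp only [pairing_add_right, pairing_sub_right] at a1 a2
      linarith
    have key : ∀ z, u.pt + s • r + z ∈ P → pairing f z = 0 → ∃ t : ℝ, t ≤ 0 ∧ z = t • r := by
      intro z hz hfz
      have : u.pt + s • r + z ∈ face P f := by
        refine ⟨hz, fun b hb => ?_⟩
        rw [pairing_add_right _ _ z, hfz, add_zero]
        exact hw.2 b hb
      rw [hface, segment_eq_image'] at this
      obtain ⟨θ, hθ, hθz⟩ := this
      refine ⟨(θ - 1) * s, mul_nonpos_of_nonpos_of_nonneg (by linarith [hθ.2]) hs0.le, ?_⟩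
      simp only [add_sub_cancel_left, smul_smul, add_assoc, add_right_inj] at hθz
      rw [sub_mul, one_mul, sub_smul, hθz, add_sub_cancel_left]
    obtain ⟨t, ht, rfl⟩ := key y h1 hfy
    obtain ⟨t', ht', htt⟩ := key (-(t • r)) (by rwa [← sub_eq_add_neg])
      (by rw [pairing_neg_right, hfy, neg_zero])
    have : t = 0 := by
      have := congrArg (pairing h) htt
      simp only [pairing_neg_right, pairing_smul_right, hhr, mul_one] at this
      linarith
    rw [this, zero_smul]
  refine ⟨⟨u.pt + s • r, hwv⟩, ⟨fun heq => ?_, f, hface⟩, s, hs0, rfl⟩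
  have : u.pt = u.pt + s • r := congrArg Vert.pt heq
  exact (smul_ne_zero hs0.ne' hr0) (left_eq_add.1 this)

/-- The simplex method: a vertex that is not minimal has a lower neighbour. -/
lemma IsPoly.exists_adj_lt (hP : IsPoly P) {c y : NR d} (hc : c ∈ tailDual P) (u : Vert P)
    (hy : y ∈ P) (hlt : pairing c y < pairing c u.pt) :
    ∃ w : Vert P, (edgeGraph P).Adj u w ∧ pairing c w.pt < pairing c u.pt := by
  obtain ⟨h, hu⟩ := u.2
  change face P h = {u.pt} at hu
  have hy0 : y - u.pt ≠ 0 := fun h0 => by rw [sub_eq_zero.1 h0] at hlt; exact hlt.false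
  have hpos := pairing_pos_of_feasible hu (feasible_sub hy) hy0
  have hk := smul_mem_vertexFigure hu (feasible_sub hy) hy0
  obtain ⟨⟨r, g, hr⟩, hmin⟩ := (hP.isPoly_vertexFigure u.mem h).exists_vert_le
    (hP.isPointed_vertexFigure hu ⟨_, hk⟩) ⟨_, hk⟩ (hP.mem_tailDual_vertexFigure hu ⟨_, hk⟩ c)
  have hcr : pairing c r < 0 := by
    refine (hmin _ hk).trans_lt ?_
    rw [pairing_smul_right, pairing_sub_right c]
    exact mul_neg_of_pos_of_neg (inv_pos.2 hpos) (by linarith)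
  obtain ⟨w, hw, s, hs, hws⟩ := hP.exists_adj_of_vertexFigure hu hr hc hcr
  refine ⟨w, hw, ?_⟩
  rw [hws, pairing_add_right, pairing_smul_right]
  linarith [mul_neg_of_pos_of_neg hs hcr]

/-- The simplex method inside the face cut out by `f`. It follows from the simplex method for
`c + l f` with `l` large, as the vertices outside the face then lie higher than `u`. -/
lemma IsPoly.exists_adj_lt_in_face (hP : IsPoly P) {c f y : NR d} (hc : c ∈ tailDual P)
    (u : Vert P) (hu : u.pt ∈ face P f) (hy : y ∈ face P f)
    (hlt : pairing c y < pairing c u.pt) :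
    ∃ w : Vert P, (edgeGraph P).Adj u w ∧ w.pt ∈ face P f ∧
      pairing c w.pt < pairing c u.pt := by
  have := hP.finite_vert
  have hfy : pairing f y = pairing f u.pt := le_antisymm (hy.2 _ hu.1) (hu.2 _ hy.1)
  have hev : ∀ᶠ l : ℝ in atTop, ∀ w : Vert P, pairing f u.pt < pairing f w.pt →
      pairing (c + l • f) u.pt < pairing (c + l • f) w.pt := by
    rw [eventually_all]
    intro w
    filter_upwards [eventually_gt_atTop
      ((pairing c u.pt - pairing c w.pt) / (pairing f w.pt - pairing f u.pt))] with l hl hw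
    rw [div_lt_iff₀ (sub_pos.2 hw)] at hl
    simp only [pairing_add_left, pairing_smul_left]
    linarith
  obtain ⟨l, hl, hl0⟩ := (hev.and (eventually_ge_atTop 0)).exists
  have hfd : f ∈ tailDual P := mem_tailDual_of_forall_le hu.1 hu.2
  have hcl : c + l • f ∈ tailDual P := fun a ha => by
    rw [pairing_add_left, pairing_smul_left]
    exact add_nonneg (hc a ha) (mul_nonneg hl0 (hfd a ha))
  obtain ⟨w, hw, hlt'⟩ := hP.exists_adj_lt hcl u hy.1 (by
    simp only [pairing_add_left, pairing_smul_left, hfy]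
    linarith)
  have hfw : pairing f w.pt = pairing f u.pt := by
    refine le_antisymm ?_ (hu.2 _ w.mem)
    by_contra hcon
    exact (hl w (not_le.1 hcon)).not_gt hlt'
  refine ⟨w, hw, ⟨w.mem, fun b hb => hfw ▸ hu.2 b hb⟩, ?_⟩
  simp only [pairing_add_left, pairing_smul_left, hfw] at hlt'
  linarith

lemma wellFounded_value {α : Type*} [Finite α] (f : α → ℝ) :
    WellFounded fun a b => f a < f b :=
  @Finite.wellFounded_of_trans_of_irrefl α _ (fun a b => f a < f b)
    ⟨fun _ _ _ => lt_trans⟩ ⟨fun _ => lt_irrefl _⟩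

/-- Inside a face with a unique lowest vertex `m`, every vertex is joined to `m` by a descending
walk. -/
lemma IsPoly.exists_walk_in_face (hP : IsPoly P) {c f : NR d} (hc : c ∈ tailDual P)
    {m : Vert P} (hm : m.pt ∈ face P f)
    (hmin : ∀ v : Vert P, v.pt ∈ face P f → v ≠ m → pairing c m.pt < pairing c v.pt)
    (u : Vert P) (hu : u.pt ∈ face P f) :
    ∃ p : (edgeGraph P).Walk u m,
      ∀ x ∈ p.support, x.pt ∈ face P f ∧ pairing c x.pt ≤ pairing c u.pt := by
  have := hP.finite_vert
  induction u using (wellFounded_value fun v : Vert P => pairing c v.pt).induction with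
  | _ u ih =>
    rcases eq_or_ne u m with rfl | hne
    · exact ⟨.nil, by simp [hu]⟩
    obtain ⟨w, hw, hwf, hlt⟩ := hP.exists_adj_lt_in_face hc u hu hm (hmin u hu hne)
    obtain ⟨p, hp⟩ := ih w hlt hwf
    refine ⟨.cons hw p, fun x hx => ?_⟩
    rw [SimpleGraph.Walk.support_cons, List.mem_cons] at hx
    rcases hx with rfl | hx
    · exact ⟨hu, le_rfl⟩
    · exact ⟨(hp x hx).1, (hp x hx).2.trans hlt.le⟩

/-- Every vertex is joined to a given lowest vertex `m` by a walk along which `c` never exceeds its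
initial value. The walk first descends to the face of lowest points and then moves to `m` inside
that face. -/
lemma IsPoly.exists_walk_le (hP : IsPoly P) {c : NR d} {m : Vert P} (hm : m.pt ∈ face P c)
    (u : Vert P) :
    ∃ p : (edgeGraph P).Walk u m, ∀ x ∈ p.support, pairing c x.pt ≤ pairing c u.pt := by
  have := hP.finite_vert
  have hc : c ∈ tailDual P := mem_tailDual_of_forall_le hm.1 hm.2
  induction u using (wellFounded_value fun v : Vert P => pairing c v.pt).induction with
  | _ u ih =>
    by_cases hu : pairing c m.pt < pairing c u.pt
    · obtain ⟨w, hw, hlt⟩ := hP.exists_adj_lt hc u m.mem hu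
      obtain ⟨p, hp⟩ := ih w hlt
      refine ⟨.cons hw p, fun x hx => ?_⟩
      rw [SimpleGraph.Walk.support_cons, List.mem_cons] at hx
      rcases hx with rfl | hx
      · exact le_rfl
      · exact (hp x hx).trans hlt.le
    · obtain ⟨g, hg⟩ := m.2
      change face P g = {m.pt} at hg
      have huf : u.pt ∈ face P c := ⟨u.mem, fun b hb => (not_lt.1 hu).trans (hm.2 b hb)⟩
      have hgm : m.pt ∈ face P g := by rw [hg]; rfl
      obtain ⟨p, hp⟩ := hP.exists_walk_in_face (mem_tailDual_of_forall_le hgm.1 hgm.2) hm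
        (fun v _ hv => pairing_lt_of_face_eq hg v.mem fun h => hv (Vert.ext h)) u huf
      exact ⟨p, fun x hx => (hp x hx).1.2 _ u.mem⟩

end VertexFigure

/-! ### Path independence -/

section Potential

variable {d : ℕ} {P : Set (NR d)}

/-- There is a linear form that is bounded below on `P` and separates its vertices: a small
perturbation of a linear form exposing some vertex. -/
lemma IsPoly.exists_injective_pairing (hP : IsPoly P) (v₀ : Vert P) :
    ∃ c ∈ tailDual P, Function.Injective fun v : Vert P => pairing c v.pt := by
  have := hP.finite_vert
  obtain ⟨c₀, hc₀⟩ := v₀.2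
  change face P c₀ = {v₀.pt} at hc₀
  obtain ⟨e, he⟩ : ∃ e : NR d, ∀ v w : Vert P, v ≠ w → pairing e (v.pt - w.pt) ≠ 0 := by
    obtain ⟨φ, hφ⟩ := Module.exists_dual_forall_apply_ne_zero (K := ℝ)
      (fun q : {q : Vert P × Vert P // q.1 ≠ q.2} => q.1.1.pt - q.1.2.pt)
      (fun q => sub_ne_zero.2 fun h => q.2 (Vert.ext h))
    refine ⟨fun i => φ (fun j => if i = j then 1 else 0), fun v w hvw => ?_⟩
    have := hφ ⟨(v, w), hvw⟩
    rw [LinearMap.pi_apply_eq_sum_univ] at this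
    simpa only [pairing, smul_eq_mul, mul_comm] using this
  have hinj : ∀ᶠ ε : ℝ in 𝓝[>] 0, ∀ v w : Vert P, v ≠ w →
      pairing (c₀ + ε • e) (v.pt - w.pt) ≠ 0 := by
    rw [eventually_all]
    intro v
    rw [eventually_all]
    intro w
    by_cases h0 : pairing c₀ (v.pt - w.pt) = 0
    · filter_upwards [self_mem_nhdsWithin] with ε hε hvw
      rw [pairing_add_left, h0, zero_add, pairing_smul_left]
      exact mul_ne_zero (ne_of_gt hε) (he v w hvw)
    · have hc : Continuous fun ε : ℝ => pairing (c₀ + ε • e) (v.pt - w.pt) := by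
        simp only [pairing_add_left, pairing_smul_left]
        fun_prop
      have h0' : pairing (c₀ + (0 : ℝ) • e) (v.pt - w.pt) ≠ 0 := by simpa using h0
      filter_upwards [((hc.tendsto 0).eventually_ne h0').filter_mono nhdsWithin_le_nhds]
        with ε hε _ using hε
  have htail : ∀ᶠ ε : ℝ in 𝓝[>] 0, c₀ + ε • e ∈ tailDual P := by
    by_cases hne : (vertexFigure P v₀.pt c₀).Nonempty
    · obtain ⟨k, hk⟩ := (hP.isPoly_vertexFigure v₀.mem c₀).exists_vert_le
        (hP.isPointed_vertexFigure hc₀ hne) hne (hP.mem_tailDual_vertexFigure hc₀ hne e)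
      have hc : Continuous fun ε : ℝ => 1 + ε * pairing e k.pt := by fun_prop
      have h1 : (0 : ℝ) < 1 + 0 * pairing e k.pt := by simp
      filter_upwards [((hc.tendsto 0).eventually (lt_mem_nhds h1)).filter_mono nhdsWithin_le_nhds,
        self_mem_nhdsWithin] with ε hε hε0 z hz
      rcases eq_or_ne z 0 with rfl | hz0
      · simp
      have hzf : ∃ ε : ℝ, 0 < ε ∧ v₀.pt + ε • z ∈ P :=
        ⟨1, one_pos, by rw [one_smul, add_comm]; exact hz _ v₀.mem⟩
      have hpos := pairing_pos_of_feasible hc₀ hzf hz0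
      have hkz := hk _ (smul_mem_vertexFigure hc₀ hzf hz0)
      rw [pairing_smul_right, inv_mul_eq_div, le_div_iff₀ hpos] at hkz
      rw [pairing_add_left, pairing_smul_left]
      have h2 := mul_le_mul_of_nonneg_left hkz (le_of_lt hε0)
      have h3 := mul_pos hε hpos
      linarith
    · refine Eventually.of_forall fun ε z hz => ?_
      have : z = 0 := by
        by_contra hz0
        exact hne ⟨_, smul_mem_vertexFigure hc₀
          ⟨1, one_pos, by rw [one_smul, add_comm]; exact hz _ v₀.mem⟩ hz0⟩
      simp [this]
  obtain ⟨ε, h1, h2⟩ := (hinj.and htail).exists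
  refine ⟨_, h2, fun v w hvw => ?_⟩
  by_contra hne
  exact h1 v w hne (by rw [pairing_sub_right]; exact sub_eq_zero.2 hvw)

lemma tCoord_symm (t : CompactEdge P → ℝ) {v w : Vert P} (h : (edgeGraph P).Adj v w) :
    tCoord t h.symm = tCoord t h := congrArg t (Subtype.ext Sym2.eq_swap)

@[simp] lemma walkSum_nil (t : CompactEdge P → ℝ) (v : Vert P) :
    walkSum t (.nil : (edgeGraph P).Walk v v) = 0 := rfl

@[simp] lemma walkSum_cons (t : CompactEdge P → ℝ) {u v w : Vert P} (h : (edgeGraph P).Adj u v)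
    (p : (edgeGraph P).Walk v w) :
    walkSum t (.cons h p) = tCoord t h • (v.pt - u.pt) + walkSum t p := by
  simp [walkSum]

lemma walkSum_concat (t : CompactEdge P → ℝ) {u v w : Vert P} (p : (edgeGraph P).Walk u v)
    (h : (edgeGraph P).Adj v w) :
    walkSum t (p.concat h) = walkSum t p + tCoord t h • (w.pt - v.pt) := by
  simp [walkSum, SimpleGraph.Walk.darts_concat]

/-- Where `S` is a potential for the edge vectors, walk sums are differences of values of `S`. -/
lemma walkSum_eq_sub {t : CompactEdge P → ℝ} {S : Vert P → NR d} {v w : Vert P}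
    (p : (edgeGraph P).Walk v w)
    (hS : ∀ x ∈ p.support, ∀ y ∈ p.support, ∀ h : (edgeGraph P).Adj x y,
      S x = S y + tCoord t h • (x.pt - y.pt)) :
    walkSum t p = S w - S v := by
  induction p with
  | nil => simp
  | @cons u v w h p ih =>
    rw [walkSum_cons, ih fun x hx y hy => hS x (List.mem_cons_of_mem _ hx) y
      (List.mem_cons_of_mem _ hy), hS u (by simp) v (by simp) h, ← neg_sub u.pt v.pt, smul_neg]
    abel

/-- Let `S` be a potential on the vertices below `u`. Two descending edges at `u` in a common
compact 2-face close up to a cycle of that face through vertices below `u`, so by the closing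
condition both extend `S` to `u` in the same way. -/
lemma potential_eq_of_twoFace {t : CompactEdge P → ℝ} (ht : ClosingConditions P t)
    (hP : IsPoly P) {c f : NR d} (hc : c ∈ tailDual P)
    (hinj : Function.Injective fun v : Vert P => pairing c v.pt) {S : Vert P → NR d} {u : Vert P}
    (hS : ∀ (x y : Vert P) (h : (edgeGraph P).Adj x y), pairing c x.pt < pairing c u.pt →
      pairing c y.pt < pairing c u.pt → S x = S y + tCoord t h • (x.pt - y.pt))
    (hF : IsCompactTwoFace P (face P f)) (huF : u.pt ∈ face P f) {w w' : Vert P}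
    (hne : w ≠ w') (h : (edgeGraph P).Adj u w) (h' : (edgeGraph P).Adj u w')
    (hw : w.pt ∈ face P f) (hw' : w'.pt ∈ face P f) (hlt : pairing c w.pt < pairing c u.pt)
    (hlt' : pairing c w'.pt < pairing c u.pt) :
    S w + tCoord t h • (u.pt - w.pt) = S w' + tCoord t h' • (u.pt - w'.pt) := by
  classical
  have := hP.finite_vert
  obtain ⟨m, hm, hmin⟩ := Set.exists_min_image {v : Vert P | v.pt ∈ face P f}
    (fun v => pairing c v.pt) (Set.toFinite _) ⟨u, huF⟩
  have hmin' : ∀ v : Vert P, v.pt ∈ face P f → v ≠ m → pairing c m.pt < pairing c v.pt :=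
    fun v hv hvm => (hmin v hv).lt_of_ne fun heq => hvm (hinj heq.symm)
  obtain ⟨p, hp⟩ := hP.exists_walk_in_face hc hm hmin' w hw
  obtain ⟨p', hp'⟩ := hP.exists_walk_in_face hc hm hmin' w' hw'
  -- a path from `w` to `w'` in the 2-face that stays strictly below `u`
  set q := (p.append p'.reverse).bypass with hq
  have hqs : ∀ x ∈ q.support, x.pt ∈ face P f ∧ pairing c x.pt < pairing c u.pt := by
    intro x hx
    have hx' := SimpleGraph.Walk.support_bypass_subset_support _ hx
    rw [SimpleGraph.Walk.mem_support_append_iff, SimpleGraph.Walk.support_reverse,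
      List.mem_reverse] at hx'
    rcases hx' with hx' | hx'
    · exact ⟨(hp x hx').1, (hp x hx').2.trans_lt hlt⟩
    · exact ⟨(hp' x hx').1, (hp' x hx').2.trans_lt hlt'⟩
  have huq : u ∉ q.support := fun hu => (hqs u hu).2.false
  have hcyc : (SimpleGraph.Walk.cons h (q.concat h'.symm)).IsCycle := by
    rw [SimpleGraph.Walk.cons_isCycle_iff]
    refine ⟨((SimpleGraph.Walk.bypass_isPath _).concat huq _), ?_⟩
    rw [SimpleGraph.Walk.edges_concat, List.concat_eq_append, List.mem_append, List.mem_singleton]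
    rintro (he | he)
    · exact huq (q.fst_mem_support_of_mem_edges he)
    · rw [Sym2.eq_iff] at he
      rcases he with ⟨-, he⟩ | ⟨-, he⟩
      · exact h.ne he.symm
      · exact hne he
  have hsum := ht _ hF u _ hcyc (by
    intro x hx
    rw [SimpleGraph.Walk.support_cons, SimpleGraph.Walk.support_concat] at hx
    simp only [List.mem_cons, List.mem_append, List.not_mem_nil,
      or_false] at hx
    rcases hx with rfl | hx | rfl
    · exact huF
    · exact (hqs x hx).1
    · exact huF)
  rw [walkSum_cons, walkSum_concat, walkSum_eq_sub (S := S) q fun x hx y hy hxy =>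
    hS x y hxy (hqs x hx).2 (hqs y hy).2, tCoord_symm t h', ← neg_sub u.pt w.pt, smul_neg] at hsum
  rw [← sub_eq_zero, ← neg_eq_zero, ← hsum]
  abel

/-- An edge at `u` gives a vertex of the vertex figure of `u`. -/
lemma face_vertexFigure_of_adj {u w : Vert P} {h f : NR d} (hu : face P h = {u.pt}) (hne : u ≠ w)
    (hf : face P f = segment ℝ u.pt w.pt) :
    face (vertexFigure P u.pt h) f = {(pairing h (w.pt - u.pt))⁻¹ • (w.pt - u.pt)} := by
  have hwu : w.pt - u.pt ≠ 0 := sub_ne_zero.2 fun heq => hne (Vert.ext heq.symm)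
  have huf : u.pt ∈ face P f := by rw [hf]; exact left_mem_segment ℝ _ _
  have hwf : w.pt ∈ face P f := by rw [hf]; exact right_mem_segment ℝ _ _
  have hpos := pairing_pos_of_feasible hu (feasible_sub w.mem) hwu
  refine face_eq_singleton (smul_mem_vertexFigure hu (feasible_sub w.mem) hwu) fun x hx hxne => ?_
  have h0 : pairing f (w.pt - u.pt) = 0 := by
    rw [pairing_sub_right, sub_eq_zero]
    exact le_antisymm (hwf.2 _ u.mem) (huf.2 _ w.mem)
  rw [pairing_smul_right, h0, mul_zero]
  obtain ⟨⟨ε, hε, hm⟩, hx1⟩ := hx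
  have hle := huf.2 _ hm
  rw [pairing_add_right, pairing_smul_right] at hle
  refine (nonneg_of_mul_nonneg_right (by linarith : 0 ≤ ε * pairing f x) hε).lt_of_ne
    fun heq => hxne ?_
  have hmf : u.pt + ε • x ∈ face P f := ⟨hm, fun b hb => by
    rw [pairing_add_right, pairing_smul_right, ← heq, mul_zero, add_zero]
    exact huf.2 b hb⟩
  rw [hf, segment_eq_image'] at hmf
  obtain ⟨θ, -, hθ⟩ := hmf
  have hθ' : θ • (w.pt - u.pt) = ε • x := add_left_cancel hθ
  have hεθ : θ * pairing h (w.pt - u.pt) = ε := by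
    rw [← pairing_smul_right, hθ', pairing_smul_right, hx1, mul_one]
  have hx' : x = ε⁻¹ • θ • (w.pt - u.pt) := by rw [hθ', inv_smul_smul₀ hε.ne']
  have hθ0 : θ ≠ 0 := by rintro rfl; rw [zero_mul] at hεθ; exact hε.ne hεθ
  rw [hx', ← hεθ, smul_smul, mul_inv, mul_comm θ⁻¹, mul_assoc, inv_mul_cancel₀ hθ0, mul_one]

/-- An edge of the vertex figure in descending directions spans a compact 2-face. -/
lemma IsPoly.isCompactTwoFace_of_vertexFigure (hP : IsPoly P) {u w w' : Vert P} {h g z z' c : NR d}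
    (hu : face P h = {u.pt}) (hzz : z ≠ z')
    (hg : face (vertexFigure P u.pt h) g = segment ℝ z z') (hc : c ∈ tailDual P)
    (hcz : pairing c z < 0) (hcz' : pairing c z' < 0) {s s' : ℝ} (hs : 0 < s) (hs' : 0 < s')
    (hw : w.pt = u.pt + s • z) (hw' : w'.pt = u.pt + s' • z') :
    ∃ f, IsCompactTwoFace P (face P f) ∧ u.pt ∈ face P f ∧ w.pt ∈ face P f ∧
      w'.pt ∈ face P f := by
  have hz : z ∈ face (vertexFigure P u.pt h) g := by rw [hg]; exact left_mem_segment ℝ _ _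
  have hz' : z' ∈ face (vertexFigure P u.pt h) g := by rw [hg]; exact right_mem_segment ℝ _ _
  set f := g - pairing g z • h with hf
  have hfz : pairing f z = 0 := by
    rw [hf, pairing_sub_left, pairing_smul_left, hz.1.2, mul_one, sub_self]
  have hfz' : pairing f z' = 0 := by
    rw [hf, pairing_sub_left, pairing_smul_left, hz'.1.2, mul_one, sub_eq_zero]
    exact le_antisymm (hz'.2 _ hz.1) (hz.2 _ hz'.1)
  have hiff : ∀ x, x ∈ face P f ↔ x ∈ P ∧ pairing f (x - u.pt) = 0 := fun x =>
    mem_face_iff_of_vertexFigure hu hz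
  have huf : u.pt ∈ face P f := (hiff _).2 ⟨u.mem, by simp⟩
  have hwf : w.pt ∈ face P f := (hiff _).2 ⟨w.mem, by
    rw [hw, add_sub_cancel_left, pairing_smul_right, hfz, mul_zero]⟩
  have hwf' : w'.pt ∈ face P f := (hiff _).2 ⟨w'.mem, by
    rw [hw', add_sub_cancel_left, pairing_smul_right, hfz', mul_zero]⟩
  have hcone : ∀ x ∈ face P f, ∃ α β : ℝ, 0 ≤ α ∧ 0 ≤ β ∧ x = u.pt + (α • z + β • z') := by
    intro x hx
    rcases eq_or_ne x u.pt with rfl | hxu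
    · exact ⟨0, 0, le_rfl, le_rfl, by simp⟩
    have hxu' := sub_ne_zero.2 hxu
    have hpos := pairing_pos_of_feasible hu (feasible_sub hx.1) hxu'
    have hm := smul_mem_face_vertexFigure hu hz (feasible_sub hx.1) hxu' ((hiff x).1 hx).2
    rw [hg] at hm
    obtain ⟨a, b, ha, hb, -, hab⟩ := hm
    refine ⟨pairing h (x - u.pt) * a, pairing h (x - u.pt) * b, by positivity, by positivity, ?_⟩
    rw [mul_smul, mul_smul, ← smul_add, hab, smul_inv_smul₀ hpos.ne', add_sub_cancel]
  have hcpt : IsCompact (face P f) := by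
    obtain ⟨v, hv⟩ := hP.exists_vert_le u.isPointed ⟨_, u.mem⟩ hc
    have hcl : IsClosed (face P f) := by
      have : face P f = P ∩ {x | pairing f (x - u.pt) = 0} := Set.ext hiff
      rw [this]
      exact hP.isClosed.inter (isClosed_eq ((continuous_pairing f).comp (by fun_prop))
        continuous_const)
    have himg : IsCompact ((fun q : ℝ × ℝ => u.pt + (q.1 • z + q.2 • z')) ''
        (Set.Icc 0 ((pairing c u.pt - pairing c v.pt) / (-pairing c z)) ×ˢ
          Set.Icc 0 ((pairing c u.pt - pairing c v.pt) / (-pairing c z')))) :=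
      (isCompact_Icc.prod isCompact_Icc).image (by fun_prop)
    refine himg.of_isClosed_subset hcl fun x hx => ?_
    obtain ⟨α, β, hα, hβ, rfl⟩ := hcone x hx
    have hle := hv _ hx.1
    simp only [pairing_add_right, pairing_smul_right] at hle
    have h1 := mul_nonpos_of_nonneg_of_nonpos hα hcz.le
    have h2 := mul_nonpos_of_nonneg_of_nonpos hβ hcz'.le
    refine ⟨(α, β), ⟨⟨hα, ?_⟩, hβ, ?_⟩, rfl⟩
    · rw [le_div_iff₀ (neg_pos.2 hcz)]
      linarith
    · rw [le_div_iff₀ (neg_pos.2 hcz')]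
      linarith
  have hli : LinearIndependent ℝ ![z, z'] := by
    rw [LinearIndependent.pair_iff]
    intro α β hαβ
    have h1 := congrArg (pairing h) hαβ
    simp only [pairing_add_right, pairing_smul_right, hz.1.2, hz'.1.2, mul_one,
      pairing_zero_right] at h1
    obtain rfl : β = -α := by linarith
    rw [neg_smul, ← sub_eq_add_neg, ← smul_sub, smul_eq_zero] at hαβ
    have : α = 0 := hαβ.resolve_right (sub_ne_zero.2 hzz)
    simp [this]
  have hspan : vectorSpan ℝ (face P f) = Submodule.span ℝ (Set.range ![z, z']) := by
    have hmz : z ∈ Submodule.span ℝ (Set.range ![z, z']) := Submodule.subset_span ⟨0, rfl⟩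
    have hmz' : z' ∈ Submodule.span ℝ (Set.range ![z, z']) := Submodule.subset_span ⟨1, rfl⟩
    apply le_antisymm
    · rw [vectorSpan_def, Submodule.span_le]
      rintro _ ⟨x, hx, y, hy, rfl⟩
      obtain ⟨α, β, -, -, rfl⟩ := hcone x hx
      obtain ⟨α', β', -, -, rfl⟩ := hcone y hy
      simp only [vsub_eq_sub, add_sub_add_left_eq_sub]
      exact Submodule.sub_mem _
        (Submodule.add_mem _ (Submodule.smul_mem _ _ hmz) (Submodule.smul_mem _ _ hmz'))
        (Submodule.add_mem _ (Submodule.smul_mem _ _ hmz) (Submodule.smul_mem _ _ hmz'))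
    · rw [Submodule.span_le]
      rintro _ ⟨i, rfl⟩
      fin_cases i
      · have := vsub_mem_vectorSpan ℝ hwf huf
        rw [hw, vsub_eq_sub, add_sub_cancel_left] at this
        simpa [hs.ne'] using Submodule.smul_mem _ s⁻¹ this
      · have := vsub_mem_vectorSpan ℝ hwf' huf
        rw [hw', vsub_eq_sub, add_sub_cancel_left] at this
        simpa [hs'.ne'] using Submodule.smul_mem _ s'⁻¹ this
  refine ⟨f, ⟨⟨f, rfl⟩, hcpt, ?_⟩, huf, hwf, hwf'⟩
  rw [hspan, finrank_span_eq_card hli, Fintype.card_fin]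

/-- Two vertices on a ray from `u` coincide. -/
lemma Vert.eq_of_ray {u w w' : Vert P} {z : NR d} {s s' : ℝ} (hs : 0 < s) (hs' : 0 < s')
    (hz : z ≠ 0) (hw : w.pt = u.pt + s • z) (hw' : w'.pt = u.pt + s' • z) : w = w' := by
  have aux : ∀ {v v' : Vert P} {a a' : ℝ}, 0 < a → v.pt = u.pt + a • z →
      v'.pt = u.pt + a' • z → ¬ a < a' := by
    intro v v' a a' ha hv hv' hlt
    obtain ⟨g, hg⟩ := v.2
    have h1 := pairing_lt_of_face_eq hg u.mem (by
      change u.pt ≠ v.pt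
      rw [hv]; simp [ha.ne', hz])
    have h2 := pairing_lt_of_face_eq hg v'.mem (by
      change v'.pt ≠ v.pt
      rw [hv, hv', Ne, add_right_inj, ← sub_eq_zero, ← sub_smul]
      simp [(sub_pos.2 hlt).ne', hz])
    change pairing g v.pt < _ at h1 h2
    rw [hv, pairing_add_right, pairing_smul_right] at h1
    rw [hv, hv', pairing_add_right, pairing_smul_right, pairing_add_right,
      pairing_smul_right] at h2
    have h3 : 0 < (a' - a) * pairing g z := by linarith
    have h4 := pos_of_mul_pos_right h3 (sub_pos.2 hlt).le
    linarith [mul_pos ha h4]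
  have : s = s' := le_antisymm (not_lt.1 (aux hs' hw' hw)) (not_lt.1 (aux hs hw hw'))
  exact Vert.ext (by rw [hw, hw', this])

/-- Local confluence: all descending edges at `u` extend the potential `S` to `u` in the same way,
since they are connected through descending edges with consecutive ones in a common 2-face. This is
the connectedness of the part `c < 0` of the edge graph of the vertex figure. -/
lemma potential_eq_of_adj {t : CompactEdge P → ℝ} (ht : ClosingConditions P t)
    (hP : IsPoly P) {c : NR d} (hc : c ∈ tailDual P)
    (hinj : Function.Injective fun v : Vert P => pairing c v.pt) {S : Vert P → NR d} {u : Vert P}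
    (hS : ∀ (x y : Vert P) (h : (edgeGraph P).Adj x y), pairing c x.pt < pairing c u.pt →
      pairing c y.pt < pairing c u.pt → S x = S y + tCoord t h • (x.pt - y.pt))
    {w w' : Vert P} (ha : (edgeGraph P).Adj u w) (ha' : (edgeGraph P).Adj u w')
    (hlt : pairing c w.pt < pairing c u.pt) (hlt' : pairing c w'.pt < pairing c u.pt) :
    S w + tCoord t ha • (u.pt - w.pt) = S w' + tCoord t ha' • (u.pt - w'.pt) := by
  obtain ⟨h, hu⟩ := u.2
  change face P h = {u.pt} at hu
  have lower : ∀ {x : Vert P} {z : NR d} {s : ℝ}, 0 < s → x.pt = u.pt + s • z → pairing c z < 0 →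
      pairing c x.pt < pairing c u.pt := by
    intro x z s hs hx hz
    rw [hx, pairing_add_right, pairing_smul_right]
    linarith [mul_neg_of_pos_of_neg hs hz]
  have chain : ∀ {z z' : Vert (vertexFigure P u.pt h)}
      (p : (edgeGraph (vertexFigure P u.pt h)).Walk z z'),
      (∀ x ∈ p.support, pairing c x.pt < 0) → ∀ {w w' : Vert P} (ha : (edgeGraph P).Adj u w)
      (ha' : (edgeGraph P).Adj u w') {s s' : ℝ}, 0 < s → 0 < s' → w.pt = u.pt + s • z.pt →
      w'.pt = u.pt + s' • z'.pt →
      S w + tCoord t ha • (u.pt - w.pt) = S w' + tCoord t ha' • (u.pt - w'.pt) := by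
    intro z z' p
    induction p with
    | @nil z =>
      intro hp w w' ha ha' s s' hs hs' hw hw'
      have hz0 : z.pt ≠ 0 := fun h0 => by
        have := hp z (by simp)
        rw [h0, pairing_zero_right] at this
        exact this.false
      obtain rfl := Vert.eq_of_ray hs hs' hz0 hw hw'
      rfl
    | @cons z y z' hzy p ih =>
      intro hp w w' ha ha' s s' hs hs' hw hw'
      have hcz := hp z (by simp)
      have hcy := hp y (by simp)
      obtain ⟨gy, hgy⟩ := y.2
      change face _ gy = {y.pt} at hgy
      obtain ⟨x, hx, r, hr, hxr⟩ := hP.exists_adj_of_vertexFigure hu hgy hc hcy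
      refine Eq.trans ?_ (ih (fun q hq => hp q (List.mem_cons_of_mem _ hq)) hx ha' hr hs' hxr hw')
      obtain ⟨hne, g, hg⟩ := hzy
      obtain ⟨f, hF, huF, hwF, hxF⟩ := hP.isCompactTwoFace_of_vertexFigure hu
        (fun heq => hne (Vert.ext heq)) hg hc hcz hcy hs hr hw hxr
      rcases eq_or_ne w x with rfl | hwx
      · rfl
      · exact potential_eq_of_twoFace ht hP hc hinj hS hF huF hwx ha hx hwF hxF
          (lower hs hw hcz) (lower hr hxr hcy)
  have toK : ∀ {w : Vert P}, (edgeGraph P).Adj u w → pairing c w.pt < pairing c u.pt →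
      ∃ z : Vert (vertexFigure P u.pt h), pairing c z.pt < 0 ∧
        ∃ s : ℝ, 0 < s ∧ w.pt = u.pt + s • z.pt := by
    rintro w ⟨hne, f, hf⟩ hlt
    have hpos := pairing_pos_of_feasible hu (feasible_sub w.mem)
      (sub_ne_zero.2 fun heq => hne (Vert.ext heq.symm))
    refine ⟨⟨_, f, face_vertexFigure_of_adj hu hne hf⟩, ?_, _, hpos, ?_⟩
    · change pairing c ((pairing h (w.pt - u.pt))⁻¹ • (w.pt - u.pt)) < 0
      rw [pairing_smul_right, pairing_sub_right c]
      exact mul_neg_of_pos_of_neg (inv_pos.2 hpos) (by linarith)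
    · change w.pt = u.pt + _ • (_ • (w.pt - u.pt))
      rw [smul_inv_smul₀ hpos.ne', add_sub_cancel]
  obtain ⟨z, hz, s, hs, hw⟩ := toK ha hlt
  obtain ⟨z', hz', s', hs', hw'⟩ := toK ha' hlt'
  have hne : (vertexFigure P u.pt h).Nonempty := ⟨_, z.mem⟩
  have hK := hP.isPoly_vertexFigure u.mem h
  obtain ⟨m, hm⟩ := hK.exists_vert_le (hP.isPointed_vertexFigure hu hne) hne
    (hP.mem_tailDual_vertexFigure hu hne c)
  have hm' : m.pt ∈ face (vertexFigure P u.pt h) c := ⟨m.mem, hm⟩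
  obtain ⟨p, hp⟩ := hK.exists_walk_le hm' z
  obtain ⟨p', hp'⟩ := hK.exists_walk_le hm' z'
  refine chain (p.append p'.reverse) (fun x hx => ?_) ha ha' hs hs' hw hw'
  rw [SimpleGraph.Walk.mem_support_append_iff, SimpleGraph.Walk.support_reverse,
    List.mem_reverse] at hx
  rcases hx with hx | hx
  · exact (hp x hx).trans_lt hz
  · exact (hp' x hx).trans_lt hz'

/-- The closing conditions along compact 2-faces integrate to a potential on the vertices. -/
lemma ClosingConditions.exists_potential {t : CompactEdge P → ℝ} (ht : ClosingConditions P t)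
    (hP : IsPoly P) :
    ∃ S : Vert P → NR d, ∀ (x y : Vert P) (h : (edgeGraph P).Adj x y),
      S x = S y + tCoord t h • (x.pt - y.pt) := by
  classical
  have := hP.finite_vert
  rcases isEmpty_or_nonempty (Vert P) with hE | ⟨⟨v₀⟩⟩
  · exact ⟨fun _ => 0, fun x => (hE.false x).elim⟩
  obtain ⟨c, hc, hinj⟩ := hP.exists_injective_pairing v₀
  have hwf := wellFounded_value fun v : Vert P => pairing c v.pt
  -- define the potential by descending along a chosen edge
  let S : Vert P → NR d := hwf.fix fun u IH =>
    if h : ∃ w, (edgeGraph P).Adj u w ∧ pairing c w.pt < pairing c u.pt then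
      IH h.choose h.choose_spec.2 + tCoord t h.choose_spec.1 • (u.pt - h.choose.pt) else 0
  have hSfix : ∀ u, (∃ w, (edgeGraph P).Adj u w ∧ pairing c w.pt < pairing c u.pt) →
      ∃ (w : Vert P) (h : (edgeGraph P).Adj u w), pairing c w.pt < pairing c u.pt ∧
        S u = S w + tCoord t h • (u.pt - w.pt) := fun u hu => by
    refine ⟨hu.choose, hu.choose_spec.1, hu.choose_spec.2, ?_⟩
    simp only [S]
    rw [hwf.fix_eq, dif_pos hu]
  have key : ∀ (u w : Vert P) (h : (edgeGraph P).Adj u w), pairing c w.pt < pairing c u.pt →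
      S u = S w + tCoord t h • (u.pt - w.pt) := by
    intro u
    induction u using hwf.induction with
    | _ u ih =>
      intro w h hlt
      obtain ⟨x, hx, hxlt, hSx⟩ := hSfix u ⟨w, h, hlt⟩
      rw [hSx]
      refine potential_eq_of_adj ht hP hc hinj (fun a b hab ha hb => ?_) hx h hxlt hlt
      rcases lt_trichotomy (pairing c b.pt) (pairing c a.pt) with hba | hba | hba
      · exact ih a ha b hab hba
      · exact absurd (hinj hba) hab.ne.symm
      · rw [ih b hb a hab.symm hba, tCoord_symm t hab, ← neg_sub a.pt b.pt, smul_neg,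
          neg_add_cancel_right]
  refine ⟨S, fun x y h => ?_⟩
  rcases lt_trichotomy (pairing c y.pt) (pairing c x.pt) with hyx | hyx | hyx
  · exact key x y h hyx
  · exact absurd (hinj hyx) h.ne.symm
  · rw [key y x h.symm hyx, tCoord_symm t h, ← neg_sub x.pt y.pt, smul_neg, neg_add_cancel_right]

end Potential

/-! ### The polyhedra `P_ξ` -/

section Summand

variable {d : ℕ} {P : Set (NR d)}

lemma psi_self (vs : Vert P) {ξ : Param P} (hξ : ClosingConditions P ξ.1) (hP : IsPoly P) :
    psi P vs ξ vs = ξ.2 vs • vs.pt := by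
  obtain ⟨S, hS⟩ := hξ.exists_potential hP
  have hne : Nonempty ((edgeGraph P).Walk vs vs) := ⟨.nil⟩
  rw [psi, dif_pos hne, walkSum_eq_sub _ fun x _ y _ h => hS x y h, sub_self, add_zero]

/-- Path independence of `ψ`, stated along single edges. -/
lemma psi_sub_psi (vs : Vert P) {ξ : Param P} (hξ : ClosingConditions P ξ.1) (hP : IsPoly P)
    {v w : Vert P} (h : (edgeGraph P).Adj v w) :
    psi P vs ξ v - psi P vs ξ w = tCoord ξ.1 h • (v.pt - w.pt) := by
  obtain ⟨S, hS⟩ := hξ.exists_potential hP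
  have hpsi : ∀ v, psi P vs ξ v = ξ.2 vs • vs.pt + (S v - S vs) := fun v => by
    obtain ⟨c, hc⟩ := v.2
    change face P c = {v.pt} at hc
    obtain ⟨p, -⟩ := hP.exists_walk_le (c := c) (m := v) (by rw [hc]; rfl) vs
    have hne : Nonempty ((edgeGraph P).Walk vs v) := ⟨p⟩
    rw [psi, dif_pos hne, walkSum_eq_sub _ fun x _ y _ h => hS x y h]
  rw [hpsi, hpsi, hS v w h]
  abel

/-- To prove a property of all vertices, it suffices to prove it for one vertex and to transport it
along compact edges. -/
lemma IsPoly.vert_induction (hP : IsPoly P) {vs : Vert P} {p : Vert P → Prop} (h0 : p vs)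
    (hstep : ∀ v w, (edgeGraph P).Adj v w → p v → p w) (v : Vert P) : p v := by
  obtain ⟨c, hc⟩ := v.2
  change face P c = {v.pt} at hc
  obtain ⟨q, -⟩ := hP.exists_walk_le (c := c) (m := v) (by rw [hc]; rfl) vs
  induction q with
  | nil => exact h0
  | cons h _ ih => exact ih (hstep _ _ h h0) hc

/-- If `c` exposes the vertex `v` of `P`, then `ψ(v)` is the only lowest point among all `ψ(w)`,
because `ψ` changes by nonnegative multiples of the edges along a descending path to `v`. -/
lemma psi_lowest (vs : Vert P) {ξ : Param P} (hξ : ClosingConditions P ξ.1) (hP : IsPoly P)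
    (ht : ∀ e, 0 ≤ ξ.1 e) {c : NR d} {v : Vert P} (hv : face P c = {v.pt}) (w : Vert P) :
    psi P vs ξ w = psi P vs ξ v ∨ pairing c (psi P vs ξ v) < pairing c (psi P vs ξ w) := by
  have := hP.finite_vert
  have hvf : v.pt ∈ face P c := by rw [hv]; rfl
  induction w using (wellFounded_value fun v : Vert P => pairing c v.pt).induction with
  | _ w ih =>
    rcases eq_or_ne w v with rfl | hne
    · exact Or.inl rfl
    obtain ⟨x, hx, hlt⟩ := hP.exists_adj_lt (mem_tailDual_of_forall_le hvf.1 hvf.2) w v.mem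
      (pairing_lt_of_face_eq hv w.mem fun h => hne (Vert.ext h))
    have hdiff := psi_sub_psi vs hξ hP hx
    have htx : 0 ≤ tCoord ξ.1 hx := ht _
    rcases htx.eq_or_lt with h0 | hpos
    · rw [← h0, zero_smul, sub_eq_zero] at hdiff
      rw [hdiff]
      exact ih x hlt
    · right
      have hlt' : pairing c (psi P vs ξ x) < pairing c (psi P vs ξ w) := by
        rw [← sub_pos, ← pairing_sub_right, hdiff, pairing_smul_right, pairing_sub_right]
        exact mul_pos hpos (sub_pos.2 hlt)
      rcases ih x hlt with h | h
      · rwa [h] at hlt'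
      · exact h.trans hlt'

/-- If `c` is minimal on `P` at the vertex `v`, then it is minimal among all `ψ(w)` at `ψ(v)`: perturb
`c` by a linear form exposing `v`. -/
lemma psi_le (vs : Vert P) {ξ : Param P} (hξ : ClosingConditions P ξ.1) (hP : IsPoly P)
    (ht : ∀ e, 0 ≤ ξ.1 e) {c : NR d} {v : Vert P} (hv : v.pt ∈ face P c) (w : Vert P) :
    pairing c (psi P vs ξ v) ≤ pairing c (psi P vs ξ w) := by
  obtain ⟨g, hg⟩ := v.2
  change face P g = {v.pt} at hg
  have hle : ∀ ε : ℝ, 0 < ε → pairing (c + ε • g) (psi P vs ξ v) ≤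
      pairing (c + ε • g) (psi P vs ξ w) := by
    intro ε hε
    have hface : face P (c + ε • g) = {v.pt} := face_eq_singleton v.mem fun x hx hne => by
      simp only [pairing_add_left, pairing_smul_left]
      have h1 := mul_lt_mul_of_pos_left (pairing_lt_of_face_eq hg hx hne) hε
      linarith [hv.2 x hx]
    rcases psi_lowest vs hξ hP ht hface w with h | h
    · rw [h]
    · exact h.le
  have hcont : ∀ x : NR d, Tendsto (fun ε : ℝ => pairing (c + ε • g) x) (𝓝[>] 0)
      (𝓝 (pairing c x)) := fun x => by
    have : Continuous fun ε : ℝ => pairing (c + ε • g) x := by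
      simp only [pairing_add_left, pairing_smul_left]
      fun_prop
    simpa using (this.tendsto 0).mono_left nhdsWithin_le_nhds
  exact le_of_tendsto_of_tendsto (hcont _) (hcont _)
    (eventually_of_mem self_mem_nhdsWithin fun ε hε => hle ε hε)

lemma psi_mem_summand (vs : Vert P) (ξ : Param P) (v : Vert P) :
    psi P vs ξ v ∈ summand P vs ξ :=
  ⟨_, subset_convexHull ℝ _ ⟨v, rfl⟩, 0, zero_mem_tailCone, add_zero _⟩

lemma add_mem_summand {vs : Vert P} {ξ : Param P} {x a : NR d} (hx : x ∈ summand P vs ξ)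
    (ha : a ∈ tailCone P) : x + a ∈ summand P vs ξ := by
  obtain ⟨y, hy, z, hz, rfl⟩ := hx
  exact ⟨y, hy, z + a, tailCone_add hz ha, (add_assoc y z a).symm⟩

lemma psi_mem_face_summand (vs : Vert P) {ξ : Param P} (hξ : ClosingConditions P ξ.1)
    (hP : IsPoly P) (ht : ∀ e, 0 ≤ ξ.1 e) {c : NR d} {v : Vert P} (hv : v.pt ∈ face P c) :
    psi P vs ξ v ∈ face (summand P vs ξ) c := by
  refine ⟨psi_mem_summand vs ξ v, ?_⟩
  rintro _ ⟨y, hy, z, hz, rfl⟩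
  have h1 : pairing c (psi P vs ξ v) ≤ pairing c y :=
    convexHull_min (s := Set.range (psi P vs ξ))
      (by rintro _ ⟨w, rfl⟩; exact psi_le vs hξ hP ht hv w) (convex_halfSpace_pairing c _) hy
  have h2 := mem_tailDual_of_forall_le hv.1 hv.2 z hz
  change _ ≤ pairing c (y + z)
  rw [pairing_add_right]
  linarith

/-- If `c` exposes `v` in `P`, then it exposes `ψ(v)` in `P_ξ`. -/
lemma face_summand (vs : Vert P) {ξ : Param P} (hξ : ClosingConditions P ξ.1)
    (hP : IsPoly P) (ht : ∀ e, 0 ≤ ξ.1 e) {c : NR d} {v : Vert P} (hv : face P c = {v.pt}) :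
    face (summand P vs ξ) c = {psi P vs ξ v} := by
  refine face_eq_singleton (psi_mem_summand vs ξ v) ?_
  rintro _ ⟨y, hy, z, hz, rfl⟩ hne
  change _ < pairing c (y + z)
  have hconv : Convex ℝ {y | y = psi P vs ξ v ∨ pairing c (psi P vs ξ v) < pairing c y} := by
    intro y hy y' hy' a b ha hb hab
    rcases ha.eq_or_lt with rfl | ha
    · obtain rfl : b = 1 := by linarith
      simpa using hy'
    rcases hb.eq_or_lt with rfl | hb
    · obtain rfl : a = 1 := by linarith
      simpa using hy
    have hsum : pairing c (psi P vs ξ v) =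
        a * pairing c (psi P vs ξ v) + b * pairing c (psi P vs ξ v) := by
      rw [← add_mul, hab, one_mul]
    have hy1 : ∀ {x : NR d}, (x = psi P vs ξ v ∨ pairing c (psi P vs ξ v) < pairing c x) →
        pairing c (psi P vs ξ v) ≤ pairing c x := by
      rintro x (rfl | h)
      · exact le_rfl
      · exact h.le
    have e1 := mul_le_mul_of_nonneg_left (hy1 hy) ha.le
    have e2 := mul_le_mul_of_nonneg_left (hy1 hy') hb.le
    rcases hy with rfl | hy
    · rcases hy' with rfl | hy'
      · left
        rw [← add_smul, hab, one_smul]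
      · right
        have := mul_lt_mul_of_pos_left hy' hb
        simp only [pairing_add_right, pairing_smul_right]
        linarith
    · right
      have := mul_lt_mul_of_pos_left hy ha
      simp only [pairing_add_right, pairing_smul_right]
      linarith
  have h1 := convexHull_min (s := Set.range (psi P vs ξ))
    (by rintro _ ⟨w, rfl⟩; exact psi_lowest vs hξ hP ht hv w) hconv hy
  have h2 : z = 0 ∨ 0 < pairing c z := by
    rw [or_iff_not_imp_left]
    intro hz0
    have := pairing_lt_of_face_eq hv (hz _ v.mem) (by simpa using hz0)
    rw [pairing_add_right] at this
    linarith
  rw [pairing_add_right]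
  rcases h1 with rfl | h1
  · rcases h2 with rfl | h2
    · exact absurd (add_zero _) hne
    · linarith
  · rcases h2 with rfl | h2
    · simpa using h1
    · linarith

lemma vertexIn_eq {Q : Set (NR d)} {v : Vert P} {q : NR d}
    (hq : ∀ c, face P c = {v.pt} → face Q c = {q}) : vertexIn P Q v = q := by
  have hspec := Classical.epsilon_spec (p := fun q => ∀ c, face P c = {v.pt} → face Q c = {q})
    ⟨q, hq⟩
  obtain ⟨c, hc⟩ := v.2
  exact Set.singleton_injective ((hspec c hc).symm.trans (hq c hc))

lemma vertexIn_summand (vs : Vert P) {ξ : Param P} (hξ : ClosingConditions P ξ.1)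
    (hP : IsPoly P) (ht : ∀ e, 0 ≤ ξ.1 e) (v : Vert P) :
    vertexIn P (summand P vs ξ) v = psi P vs ξ v :=
  vertexIn_eq fun _ hc => face_summand vs hξ hP ht hc

lemma dilation_summand (vs : Vert P) {ξ : Param P} (hξ : ClosingConditions P ξ.1)
    (hP : IsPoly P) (ht : ∀ e, 0 ≤ ξ.1 e) : dilation P (summand P vs ξ) = ξ.1 := by
  funext e
  have hspec := Classical.epsilon_spec (p := fun r : ℝ => 0 ≤ r ∧ ∀ v w : Vert P,
    (e : Sym2 (Vert P)) = s(v, w) → vertexIn P (summand P vs ξ) w - vertexIn P (summand P vs ξ) v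
      = r • (w.pt - v.pt)) ⟨ξ.1 e, ht e, fun v w hvw => by
        have h : (edgeGraph P).Adj w v := by
          have := e.2
          rw [hvw] at this
          exact (SimpleGraph.mem_edgeSet _).1 this |>.symm
        rw [vertexIn_summand vs hξ hP ht, vertexIn_summand vs hξ hP ht, psi_sub_psi vs hξ hP h]
        rw [show tCoord ξ.1 h = ξ.1 e from
          congrArg ξ.1 (Subtype.ext (Sym2.eq_swap.trans hvw.symm))]⟩
  obtain ⟨⟨v, w⟩, he⟩ := e
  have h : (edgeGraph P).Adj v w := he
  have h1 := hspec.2 v w rfl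
  rw [vertexIn_summand vs hξ hP ht, vertexIn_summand vs hξ hP ht,
    psi_sub_psi vs hξ hP h.symm, tCoord_symm] at h1
  have hne : w.pt - v.pt ≠ 0 := sub_ne_zero.2 fun heq => h.ne (Vert.ext heq.symm)
  exact (smul_left_injective ℝ hne h1).symm

lemma IsPoly.tailCone_summand (hP : IsPoly P) (vs : Vert P) {ξ : Param P}
    (hξ : ClosingConditions P ξ.1) (ht : ∀ e, 0 ≤ ξ.1 e) :
    tailCone (summand P vs ξ) = tailCone P := by
  apply Set.Subset.antisymm
  · intro y hy
    have hP' := hP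
    obtain ⟨ι, _, a, b, rfl⟩ := hP
    rw [mem_tailCone_setOf ⟨_, vs.mem⟩]
    intro j
    have hj : a j ∈ tailDual {x | ∀ j, b j ≤ pairing (a j) x} := fun z hz =>
      (mem_tailCone_setOf ⟨_, vs.mem⟩).1 hz j
    obtain ⟨v, hv⟩ := hP'.exists_vert_le vs.isPointed ⟨_, vs.mem⟩ hj
    exact pairing_nonneg_of_mem_tailCone ⟨_, psi_mem_summand vs ξ vs⟩
      (psi_mem_face_summand vs hξ hP' ht ⟨v.mem, hv⟩).2 hy
  · intro a ha x hx
    rw [add_comm]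
    exact add_mem_summand hx ha

/-- If the corresponding vertices add up to those of `P`, so do the polyhedra. -/
lemma IsPoly.sum_summand (hP : IsPoly P) (vs : Vert P) {m : ℕ} {ξ : Fin (m + 1) → Param P}
    (hξ : ∀ i, ClosingConditions P (ξ i).1) (ht : ∀ i e, 0 ≤ (ξ i).1 e)
    (hsum : ∀ v, ∑ i, psi P vs (ξ i) v = v.pt) : ∑ i, summand P vs (ξ i) = P := by
  apply Set.Subset.antisymm
  · intro x hx
    obtain ⟨g, hg, rfl⟩ := Set.mem_fintype_sum _ _ |>.1 hx
    have hP' := hP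
    obtain ⟨ι, _, a, b, rfl⟩ := hP
    intro j
    have hj : a j ∈ tailDual {x | ∀ j, b j ≤ pairing (a j) x} := fun z hz =>
      (mem_tailCone_setOf ⟨_, vs.mem⟩).1 hz j
    obtain ⟨v, hv⟩ := hP'.exists_vert_le vs.isPointed ⟨_, vs.mem⟩ hj
    refine (v.mem j).trans ?_
    rw [← hsum v, pairing_sum_right, pairing_sum_right]
    exact Finset.sum_le_sum fun i _ =>
      (psi_mem_face_summand vs (hξ i) hP' (ht i) ⟨v.mem, hv⟩).2 _ (hg i)
  · intro x hx
    obtain ⟨y, hy, z, hz, rfl⟩ := hP.subset_convexHull_add_tailCone vs.isPointed hx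
    have hconv : Convex ℝ (∑ i, summand P vs (ξ i)) :=
      convex_sum _ fun i _ => (convex_convexHull ℝ _).add (hP.convex_tailCone ⟨_, vs.mem⟩)
    have hy' : y ∈ ∑ i, summand P vs (ξ i) := by
      refine convexHull_min ?_ hconv hy
      rintro _ ⟨v, rfl⟩
      exact Set.mem_fintype_sum _ _ |>.2 ⟨_, fun i => psi_mem_summand vs (ξ i) v, hsum v⟩
    obtain ⟨g, hg, rfl⟩ := Set.mem_fintype_sum _ _ |>.1 hy'
    refine Set.mem_fintype_sum _ _ |>.2 ⟨g + Pi.single 0 z, fun i => ?_, ?_⟩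
    · refine add_mem_summand (hg i) ?_
      by_cases hi : i = 0
      · rw [hi, Pi.single_eq_same]
        exact hz
      · rw [Pi.single_eq_of_ne hi]
        exact zero_mem_tailCone
    · simp [Finset.sum_add_distrib]

end Summand

/-! ### Lattice friendly decompositions -/

section Lattice

variable {d : ℕ} {P : Set (NR d)}

/-- The lattice condition of `T_ℤ(P)` on the edges integrates to a condition on the vertices. -/
lemma mem_TInt_iff (hP : IsPoly P) (vs : Vert P) {ξ : Param P} (hξ : ξ ∈ TSpace P) :
    ξ ∈ TInt P ↔ ∀ v, (∃ z : ℤ, ξ.2 v = z) ∧ psi P vs ξ v - ξ.2 v • v.pt ∈ latticePts d := by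
  have hedge : ∀ (v w : Vert P) (h : (edgeGraph P).Adj v w),
      (tCoord ξ.1 h - ξ.2 v) • v.pt - (tCoord ξ.1 h - ξ.2 w) • w.pt =
        (psi P vs ξ v - ξ.2 v • v.pt) - (psi P vs ξ w - ξ.2 w • w.pt) := by
    intro v w h
    have := psi_sub_psi vs hξ.1 hP h
    rw [sub_sub_sub_comm, this, sub_smul, sub_smul, smul_sub]
    abel
  constructor
  · rintro ⟨-, hz, hl⟩ v
    refine ⟨hz v, ?_⟩
    induction v using hP.vert_induction (vs := vs) with
    | h0 =>
      rw [psi_self vs hξ.1 hP, sub_self]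
      exact zero_mem _
    | hstep v w h ih =>
      have := hl v w h
      rw [hedge] at this
      simpa using sub_mem ih this
  · intro h
    refine ⟨hξ, fun v => (h v).1, fun v w hvw => ?_⟩
    rw [hedge]
    exact sub_mem (h v).2 (h w).2

/-- If `[P]` is the sum of the `ξ i`, the corresponding vertices of the polyhedra add up to those of
`P`. The reference vertex is covered by the assumption that it is `0` or not a lattice point. -/
lemma sum_psi (hP : IsPoly P) {vs : Vert P} (hvs : vs.pt ∉ latticePts d ∨ vs.pt = 0) {m : ℕ}
    {ξ : Fin (m + 1) → Param P} (hξ : ∀ i, ClosingConditions P (ξ i).1)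
    (hsum : ∑ i, ξ i = distinguished P) (v : Vert P) : ∑ i, psi P vs (ξ i) v = v.pt := by
  induction v using hP.vert_induction (vs := vs) with
  | h0 =>
    rw [Finset.sum_congr rfl fun i _ => psi_self vs (hξ i) hP, ← Finset.sum_smul]
    rcases hvs with hvs | hvs
    · have : ∑ i, (ξ i).2 vs = 1 := by
        have := congrFun (congrArg Prod.snd hsum) vs
        simpa [distinguished, hvs, Prod.snd_sum] using this
      rw [this, one_smul]
    · rw [hvs, smul_zero]
  | hstep v w h ih =>
    have ht : ∑ i, tCoord (ξ i).1 h = 1 := by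
      have := congrFun (congrArg Prod.fst hsum) ⟨s(v, w), h⟩
      simpa [distinguished, tCoord, Prod.fst_sum] using this
    have hd : ∑ i, (psi P vs (ξ i) v - psi P vs (ξ i) w) = v.pt - w.pt := by
      rw [Finset.sum_congr rfl fun i _ => psi_sub_psi vs (hξ i) hP h, ← Finset.sum_smul, ht,
        one_smul]
    rw [Finset.sum_sub_distrib, ih] at hd
    exact sub_right_injective hd

end Lattice

end LatticeMinkowski

theorem mainTheorem2 {d : ℕ} (P : Set (LatticeMinkowski.NR d))
    (hP : LatticeMinkowski.IsRationalPolyhedron P)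
    (vs : LatticeMinkowski.Vert P)
    (hvs : vs.pt ∉ LatticeMinkowski.latticePts d ∨ vs.pt = 0)
    (m : ℕ) (ξ : Fin (m + 1) → LatticeMinkowski.Param P)
    (hξ : ∀ i, ξ i ∈ LatticeMinkowski.TPlus P)
    (hsum : ∑ i, ξ i = LatticeMinkowski.distinguished P) :
    List.TFAE
      [∀ i, ξ i ∈ LatticeMinkowski.TInt P,
       ∀ (w : LatticeMinkowski.Vert P) (i : Fin (m + 1)),
        LatticeMinkowski.vertexIn P (LatticeMinkowski.summand P vs (ξ i)) w
            ∉ LatticeMinkowski.latticePts d ↔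
          w.pt ∉ LatticeMinkowski.latticePts d ∧ (ξ i).2 w = 1,
       LatticeMinkowski.IsLatticeFriendly P
          (fun i => LatticeMinkowski.summand P vs (ξ i)) ∧
        ∀ i, LatticeMinkowski.kodairaSpencer P
          (LatticeMinkowski.summand P vs (ξ i)) = ξ i] := by
  classical
  open LatticeMinkowski in
  have hPoly : IsPoly P := hP.isPoly
  have hcl : ∀ i, ClosingConditions P (ξ i).1 := fun i => (hξ i).1.1
  have ht : ∀ i e, 0 ≤ (ξ i).1 e := fun i => (hξ i).2.1
  have hs0 : ∀ i v, 0 ≤ (ξ i).2 v := fun i => (hξ i).2.2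
  have hvertex : ∀ i v, vertexIn P (summand P vs (ξ i)) v = psi P vs (ξ i) v := fun i =>
    vertexIn_summand vs (hcl i) hPoly (ht i)
  have hpsi := sum_psi hPoly hvs hcl hsum
  have hlat : ∀ i v, v.pt ∈ latticePts d → (ξ i).2 v = 0 := fun i => (hξ i).1.2.1
  have hs1 : ∀ v : Vert P, v.pt ∉ latticePts d → ∑ i, (ξ i).2 v = 1 := fun v hv => by
    have := congrFun (congrArg Prod.snd hsum) v
    simpa [distinguished, hv, Prod.snd_sum] using this
  -- if one of the coordinates `s_v` equals `1`, the others vanish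
  have hother : ∀ (v : Vert P) (i j : Fin (m + 1)), v.pt ∉ latticePts d → (ξ i).2 v = 1 → j ≠ i →
      (ξ j).2 v = 0 := by
    intro v i j hv hi hji
    have h1 := Finset.add_sum_erase Finset.univ (fun i => (ξ i).2 v) (Finset.mem_univ i)
    have h2 : ∑ k ∈ Finset.univ.erase i, (ξ k).2 v = 0 := by
      rw [hs1 v hv, hi] at h1
      linarith
    exact (Finset.sum_eq_zero_iff_of_nonneg fun k _ => hs0 k v).1 h2 j
      (Finset.mem_erase.2 ⟨hji, Finset.mem_univ _⟩)
  -- given the second condition, exactly one of the summands is not a lattice point at a vertex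
  -- outside `N`: the vertices of the summands add up to it, so they cannot all be lattice points
  have hii : (∀ (w : Vert P) (i : Fin (m + 1)), psi P vs (ξ i) w ∉ latticePts d ↔
      w.pt ∉ latticePts d ∧ (ξ i).2 w = 1) → ∀ w : Vert P, w.pt ∉ latticePts d →
      ∃ μ, (ξ μ).2 w = 1 ∧ ∀ j, j ≠ μ → (ξ j).2 w = 0 ∧ psi P vs (ξ j) w ∈ latticePts d := by
    intro h w hw
    have : ∃ μ, psi P vs (ξ μ) w ∉ latticePts d := by
      by_contra hcon
      push Not at hcon
      exact hw (hpsi w ▸ sum_mem fun i _ => hcon i)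
    obtain ⟨μ, hμ⟩ := this
    have hμ1 := ((h w μ).1 hμ).2
    refine ⟨μ, hμ1, fun j hj => ?_⟩
    have hj0 := hother w μ j hw hμ1 hj
    refine ⟨hj0, ?_⟩
    by_contra hcon
    have := ((h w j).1 hcon).2
    rw [hj0] at this
    exact zero_ne_one this
  simp only [hvertex]
  tfae_have 1 → 2 := by
    intro h w i
    obtain ⟨⟨z, hz⟩, hl⟩ := (mem_TInt_iff hPoly vs (hξ i).1).1 (h i) w
    by_cases hw : w.pt ∈ latticePts d
    · rw [hlat i w hw, zero_smul, sub_zero] at hl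
      simp [hl, hw]
    have hz0 : (0 : ℤ) ≤ z := by
      have := hs0 i w
      rw [hz] at this
      exact_mod_cast this
    have hz1 : z ≤ 1 := by
      have : (ξ i).2 w ≤ 1 := hs1 w hw ▸
        Finset.single_le_sum (f := fun i => (ξ i).2 w) (fun k _ => hs0 k w) (Finset.mem_univ i)
      rw [hz] at this
      exact_mod_cast this
    obtain rfl | rfl : z = 0 ∨ z = 1 := by omega
    · rw [hz] at hl ⊢
      simp only [Int.cast_zero, zero_smul, sub_zero] at hl
      simp [hl]
    · rw [hz] at hl ⊢
      simp only [Int.cast_one, one_smul] at hl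
      refine ⟨fun _ => ⟨hw, by simp⟩, fun _ hcon => hw ?_⟩
      simpa using sub_mem hcon hl
  tfae_have 2 → 1 := by
    intro h i
    refine (mem_TInt_iff hPoly vs (hξ i).1).2 fun w => ?_
    by_cases hw : w.pt ∈ latticePts d
    · rw [hlat i w hw, zero_smul, sub_zero]
      refine ⟨⟨0, by simp⟩, ?_⟩
      by_contra hcon
      exact ((h w i).1 hcon).1 hw
    obtain ⟨μ, hμ, hj⟩ := hii h w hw
    by_cases hi : i = μ
    · subst hi
      refine ⟨⟨1, by simp [hμ]⟩, ?_⟩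
      have h1 := Finset.add_sum_erase Finset.univ (fun i => psi P vs (ξ i) w) (Finset.mem_univ i)
      rw [hpsi w] at h1
      rw [hμ, one_smul, ← h1, sub_add_cancel_left]
      exact neg_mem (sum_mem fun k hk => (hj k (Finset.ne_of_mem_erase hk)).2)
    · obtain ⟨h0, hl⟩ := hj i hi
      rw [h0, zero_smul, sub_zero]
      exact ⟨⟨0, by simp⟩, hl⟩
  tfae_have 2 → 3 := by
    intro h
    refine ⟨⟨hPoly.sum_summand vs hcl ht hpsi,
      fun i => hPoly.tailCone_summand vs (hcl i) (ht i), fun c hc => ?_⟩, fun i => ?_⟩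
    · obtain ⟨v, hv⟩ := hPoly.exists_vert_le vs.isPointed ⟨_, vs.mem⟩ hc
      have hface : ∀ i, psi P vs (ξ i) v ∈ face (summand P vs (ξ i)) fun j => (c j : ℝ) := fun i =>
        psi_mem_face_summand vs (hcl i) hPoly (ht i) ⟨v.mem, hv⟩
      by_cases hvl : v.pt ∈ latticePts d
      · refine ⟨0, fun i _ => ⟨_, hface i, ?_⟩⟩
        by_contra hcon
        exact ((h v i).1 hcon).1 hvl
      · obtain ⟨μ, -, hj⟩ := hii h v hvl
        exact ⟨μ, fun i hi => ⟨_, hface i, (hj i hi).2⟩⟩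
    · refine Prod.ext (dilation_summand vs (hcl i) hPoly (ht i)) (funext fun v => ?_)
      simp only [kodairaSpencer, hvertex]
      by_cases hm : psi P vs (ξ i) v ∈ latticePts d
      · rw [if_pos hm]
        by_cases hv : v.pt ∈ latticePts d
        · exact (hlat i v hv).symm
        obtain ⟨μ, hμ, hj⟩ := hii h v hv
        by_cases hi : i = μ
        · subst hi
          exact absurd hm ((h v i).2 ⟨hv, hμ⟩)
        · exact (hj i hi).1.symm
      · rw [if_neg hm]
        exact ((h v i).1 hm).2.symm
  tfae_have 3 → 2 := by
    rintro ⟨-, hκ⟩ w i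
    have hw := congrFun (congrArg Prod.snd (hκ i)) w
    simp only [kodairaSpencer, hvertex] at hw
    constructor
    · intro hm
      rw [if_neg hm] at hw
      refine ⟨fun hwl => ?_, hw.symm⟩
      rw [hlat i w hwl] at hw
      exact one_ne_zero hw
    · rintro ⟨-, h1⟩ hm
      rw [if_pos hm, h1] at hw
      exact zero_ne_one hw
  tfae_finish
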